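/- Work in the complex Hilbert space $\ell^2(\mathbb Z)$. For bounded real sequences $a,b$ on $\mathbb Z$ with $\inf_n a_n>0$, the Jacobi matrix $J=J_{a,b}$ is the bounded self-adjoint operator $$(J\varphi)_n=a_{n-1}\varphi_{n-1}+b_n\varphi_n+a_n\varphi_{n+1}.$$ It is $q$-periodic ($q\ge 1$ an integer) if $a_{n+q}=a_n$ and $b_{n+q}=b_n$ for all $n$, and limit-periodic if it is a limit in operator norm of periodic Jacobi matrices. For $\eta>0$, a limit-periodic Jacobi matrix $J$ belongs to the exponential class $\mathrm{EC}(\eta)$ if there are $q_k$-periodic Jacobi matrices $J_k$ with $q_k\mid q_{k+1}$ and $q_k\ne q_{k+1}$ for all $k$ such that $\lim_{k\to\infty}e^{\eta q_{k+1}}\|J-J_k\|=0$. For $R>0$ let $\mathcal J(R)$ be the set of Jacobi matrices with $\|J\|\le R$ and $\inf_n a_n\ge R^{-1}$. Let $X$ be the position operator $(X\varphi)_n=n\varphi_n$ with domain $D(X)=\{\varphi\in\ell^2(\mathbb Z):\sum_n|n\varphi_n|^2<\infty\}$, and let $X_J(t)=e^{itJ}Xe^{-itJ}$ with domain $\{\varphi\in\ell^2(\mathbb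 Z):e^{-itJ}\varphi\in D(X)\}$. Let $\mathcal S$ be the set of $\varphi\in\ell^2(\mathbb Z)$ with $\sum_n|n|^p|\varphi_n|<\infty$ for all $p>0$. For $p>0$ put $$|X|^p_\varphi(t)=\sum_{n\in\mathbb Z}(|n|^p+1)\,|\langle\delta_n,e^{-itJ}\varphi\rangle|^2\in[0,\infty],$$ $$\beta^+_\varphi(p)=\limsup_{t\to\infty}\frac{\log|X|^p_\varphi(t)}{p\log t},\qquad \beta^-_\varphi(p)=\liminf_{t\to\infty}\frac{\log|X|^p_\varphi(t)}{p\log t}.$$ **Theorem.** For every $R>0$ there is a constant $\eta_0=\eta_0(R)>0$ such that the following holds for every Jacobi matrix $J\in\mathcal J(R)\cap\mathrm{EC}(\eta_0)$. One has $D(X_J(t))=D(X)$ for all $t\in\mathbb R$, and there is a bounded self-adjoint operator $Q_J$ on $\ell^2(\mathbb Z)$ such that $$\lim_{t\to\infty}\left\|\tfrac1t X_J(t)\varphi-Q_J\varphi\right\|=0\quad\text{for all }\varphi\in D(X),$$ and $\ker(Q_J)\cap\ell^1(\mathbb Z)=\{0\}$. In particular, $\beta^+_\varphi(p)=\beta^-_\varphi(p)=1$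 for every nonzero $\varphi\in\mathcal S$ and every $p>0$. -/

import Mathlib

open Filter Topology
open scoped ENNReal

noncomputable section

namespace JacobiDynamics

/-- The Hilbert space `ℓ²(ℤ)` of square-summable complex sequences indexed by `ℤ`. -/
abbrev L2Z : Type := lp (fun _ : ℤ => ℂ) 2

/-- A bounded weight times a translate of an `ℓ²` sequence is in `ℓ²`, with the norm bound. -/
theorem weightedShift_aux (c : ℤ → ℝ) (k : ℤ) (C : ℝ) (hC : ∀ n, |c n| ≤ C) (φ : L2Z)
    (s : Finset ℤ) :
    ∑ n ∈ s, ‖(c n : ℂ) * φ (n + k)‖ ^ (2 : ℝ≥0∞).toReal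
      ≤ (C * ‖φ‖) ^ (2 : ℝ≥0∞).toReal := by
  have hp : 0 < (2 : ℝ≥0∞).toReal := by norm_num
  have hC0 : 0 ≤ C := (abs_nonneg _).trans (hC 0)
  rw [Real.mul_rpow hC0 (norm_nonneg _)]
  calc ∑ n ∈ s, ‖(c n : ℂ) * φ (n + k)‖ ^ (2 : ℝ≥0∞).toReal
      ≤ ∑ n ∈ s, C ^ (2 : ℝ≥0∞).toReal * ‖φ (n + k)‖ ^ (2 : ℝ≥0∞).toReal := by
        refine Finset.sum_le_sum fun n _ => ?_
        rw [norm_mul, Complex.norm_real, Real.norm_eq_abs,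
          Real.mul_rpow (abs_nonneg _) (norm_nonneg _)]
        have := hC n
        gcongr
    _ = C ^ (2 : ℝ≥0∞).toReal *
          ∑ m ∈ s.map (Equiv.addRight k).toEmbedding, ‖φ m‖ ^ (2 : ℝ≥0∞).toReal := by
        rw [← Finset.mul_sum, Finset.sum_map]
        rfl
    _ ≤ C ^ (2 : ℝ≥0∞).toReal * ‖φ‖ ^ (2 : ℝ≥0∞).toReal := by
        have h := lp.sum_rpow_le_norm_rpow hp φ (s.map (Equiv.addRight k).toEmbedding)
        gcongr

/-- The bounded operator `(T φ)_n = c_n φ_{n+k}` on `ℓ²(ℤ)`, for a bounded real sequence `c`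
and `k ∈ ℤ`. -/
def weightedShift (c : ℤ → ℝ) (hc : ∃ C, ∀ n, |c n| ≤ C) (k : ℤ) : L2Z →L[ℂ] L2Z :=
  LinearMap.mkContinuous
    { toFun := fun φ => ⟨fun n => (c n : ℂ) * φ (n + k),
        memℓp_gen' (weightedShift_aux c k hc.choose hc.choose_spec φ)⟩
      map_add' := fun φ ψ => by
        ext n
        exact mul_add _ _ _
      map_smul' := fun z φ => by
        ext n
        simp [mul_left_comm] }
    hc.choose
    (fun φ => lp.norm_le_of_forall_sum_le (by norm_num)
      (mul_nonneg ((abs_nonneg _).trans (hc.choose_spec 0)) (norm_nonneg _))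
      (weightedShift_aux c k hc.choose hc.choose_spec φ))

/-- The coefficients `a, b ∈ ℓ^∞(ℤ, ℝ)`, with `inf_n a_n > 0`, of a Jacobi matrix. -/
structure JacobiMatrix where
  /-- the off-diagonal entries -/
  a : ℤ → ℝ
  /-- the diagonal entries -/
  b : ℤ → ℝ
  a_bounded : ∃ C, ∀ n, |a n| ≤ C
  b_bounded : ∃ C, ∀ n, |b n| ≤ C
  a_pos : ∃ c, 0 < c ∧ ∀ n, c ≤ a n

namespace JacobiMatrix

/-- The operator `(J φ)_n = a_{n-1} φ_{n-1} + b_n φ_n + a_n φ_{n+1}` on `ℓ²(ℤ)`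
(see `op_apply`). -/
def op (J : JacobiMatrix) : L2Z →L[ℂ] L2Z :=
  weightedShift (fun n => J.a (n - 1)) (J.a_bounded.imp fun _ h n => h (n - 1)) (-1)
    + weightedShift J.b J.b_bounded 0
    + weightedShift J.a J.a_bounded 1

theorem op_apply (J : JacobiMatrix) (φ : L2Z) (n : ℤ) :
    J.op φ n = (J.a (n - 1) : ℂ) * φ (n - 1) + (J.b n : ℂ) * φ n + (J.a n : ℂ) * φ (n + 1) := by
  have h0 : φ (n + 0) = φ n := by rw [add_zero]
  change (J.a (n - 1) : ℂ) * φ (n + -1) + (J.b n : ℂ) * φ (n + 0) + (J.a n : ℂ) * φ (n + 1) = _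
  rw [h0]
  rfl

/-- `J` is `q`-periodic (with `q ≥ 1`). -/
def IsPeriodic (J : JacobiMatrix) (q : ℕ) : Prop :=
  0 < q ∧ ∀ n : ℤ, J.a (n + q) = J.a n ∧ J.b (n + q) = J.b n

/-- `J` is a limit in operator norm of periodic Jacobi matrices. -/
def IsLimitPeriodic (J : JacobiMatrix) : Prop :=
  ∃ (Js : ℕ → JacobiMatrix) (q : ℕ → ℕ), (∀ k, (Js k).IsPeriodic (q k)) ∧
    Tendsto (fun k => ‖J.op - (Js k).op‖) atTop (𝓝 0)

/-- `J` is of exponential class `EC(η)`. -/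
def IsExpClass (η : ℝ) (J : JacobiMatrix) : Prop :=
  J.IsLimitPeriodic ∧
  ∃ (Js : ℕ → JacobiMatrix) (q : ℕ → ℕ), (∀ k, (Js k).IsPeriodic (q k)) ∧
    (∀ k, q k ∣ q (k + 1) ∧ q k ≠ q (k + 1)) ∧
    Tendsto (fun k => Real.exp (η * q (k + 1)) * ‖J.op - (Js k).op‖) atTop (𝓝 0)

/-- The class `𝒥(R)`: `‖J‖ ≤ R` and `inf_n a_n ≥ R⁻¹`. -/
def InClass (R : ℝ) (J : JacobiMatrix) : Prop :=
  ‖J.op‖ ≤ R ∧ ∀ n, R⁻¹ ≤ J.a n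

/-- The unitary propagator `e^{-itJ}` of the Schrödinger equation `i ∂ψ/∂t = J ψ`. -/
def propagator (J : JacobiMatrix) (t : ℝ) : L2Z →L[ℂ] L2Z :=
  NormedSpace.exp ((-(Complex.I * (t : ℂ))) • J.op)

end JacobiMatrix

/-- The position operator `(X φ)_n = n φ_n`, an unbounded operator with its maximal domain
`D(X) = {φ ∈ ℓ² : (n φ_n)_n ∈ ℓ²}`. -/
def position : L2Z →ₗ.[ℂ] L2Z where
  domain :=
    { carrier := {φ | Memℓp (fun n : ℤ => (n : ℂ) * φ n) 2}
      add_mem' := fun {φ ψ} hφ hψ => by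
        have h := Memℓp.add hφ hψ
        have e : (fun n : ℤ => (n : ℂ) * (φ + ψ) n)
            = (fun n : ℤ => (n : ℂ) * φ n) + fun n : ℤ => (n : ℂ) * ψ n := by
          funext n
          simp [mul_add]
        simpa only [Set.mem_ofPred_eq, e] using h
      zero_mem' := by
        have e : (fun n : ℤ => (n : ℂ) * (0 : L2Z) n) = 0 := by
          funext n
          simp
        simpa only [Set.mem_ofPred_eq, e] using zero_memℓp
      smul_mem' := fun z φ hφ => by
        have h := Memℓp.const_smul hφ z
        have e : (fun n : ℤ => (n : ℂ) * (z • φ) n) = z • fun n : ℤ => (n : ℂ) * φ n := by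
          funext n
          simp [mul_left_comm]
        simpa only [Set.mem_ofPred_eq, e] using h }
  toFun :=
    { toFun := fun φ => ⟨fun n : ℤ => (n : ℂ) * φ.1 n, φ.2⟩
      map_add' := fun φ ψ => by
        ext n
        exact mul_add _ _ _
      map_smul' := fun z φ => by
        ext n
        simp [mul_left_comm] }

namespace JacobiMatrix

/-- The Heisenberg evolution `X_J(t) = e^{itJ} X e^{-itJ}`, with its natural domain
`{φ : e^{-itJ} φ ∈ D(X)}`. -/
def heisenberg (J : JacobiMatrix) (t : ℝ) : L2Z →ₗ.[ℂ] L2Z where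
  domain := position.domain.comap (J.propagator t).toLinearMap
  toFun := (J.propagator (-t)).toLinearMap ∘ₗ position.toFun ∘ₗ
    (J.propagator t).toLinearMap.submoduleComap position.domain

/-- The moment `|X|^p_φ(t) = ∑_n (|n|^p + 1) |⟨δ_n, e^{-itJ} φ⟩|²`, valued in `[0, ∞]`. -/
def moment (J : JacobiMatrix) (p : ℝ) (φ : L2Z) (t : ℝ) : ℝ≥0∞ :=
  ∑' n : ℤ, ENNReal.ofReal ((|(n : ℝ)| ^ p + 1) * ‖J.propagator t φ n‖ ^ 2)

/-- The upper transport exponent `β⁺_φ(p)`, as an extended real number. -/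
def betaPlus (J : JacobiMatrix) (p : ℝ) (φ : L2Z) : EReal :=
  limsup (fun t : ℝ => ENNReal.log (J.moment p φ t) / ((p * Real.log t : ℝ) : EReal)) atTop

/-- The lower transport exponent `β⁻_φ(p)`, as an extended real number. -/
def betaMinus (J : JacobiMatrix) (p : ℝ) (φ : L2Z) : EReal :=
  liminf (fun t : ℝ => ENNReal.log (J.moment p φ t) / ((p * Real.log t : ℝ) : EReal)) atTop

end JacobiMatrix

/-- The discrete Schwartz space `𝒮(ℤ)`. -/
def IsSchwartz (φ : L2Z) : Prop :=
  ∀ p : ℝ, 0 < p → Summable fun n : ℤ => |(n : ℝ)| ^ p * ‖φ n‖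

/-- The possibly unbounded operators `A t` are all defined on the subspace `D`, and converge
strongly on `D`, as `t → ∞`, to the bounded operator `Q`. -/
def StronglyTendstoOn (A : ℝ → (L2Z →ₗ.[ℂ] L2Z)) (D : Submodule ℂ L2Z) (Q : L2Z →L[ℂ] L2Z) :
    Prop :=
  ∃ hD : ∀ t, D ≤ (A t).domain, ∀ (φ : L2Z) (hφ : φ ∈ D),
    Tendsto (fun t : ℝ => A t ⟨φ, hD t hφ⟩) atTop (𝓝 (Q φ))

end JacobiDynamics

end

/-! On `D(X)` one has `e^{itJ} X e^{-itJ} = X + t M_t`, where `M_t` is the Cesàro mean over `[0, t]`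
of the Heisenberg evolution of the bounded velocity `A = i[J, X]`. Everything reduces to strong
convergence of `M_t` and to the kernel of its limit `Q`.

Let first `J` have period `q`, with discriminant `Δ`. Then `Δ(J) = S_q + S_{-q}`
(`aeval_discriminant_delta`), so `K = i[Δ(J), X] = iq(S_q - S_{-q})` commutes with `J` and `A` and
equals its own time average. Since `[J, M_t] = O(1/t)`, averaging the Leibniz rule gives `K = M_t
Δ'(J) + O(1/t) = Δ'(J) M_t + O(1/t)`. Comparing two times shows that `(M_t - M_s) K` is small;
telescoping along `n + 2qℤ` and the orthogonality of the `δ_n` turn this into a Cauchy rate on every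
`δ_n` (`norm_timeAverage_velocity_sub_delta_le`). The same identity bounds `‖(S_q - S_{-q})φ‖` by
`M_t φ` (`norm_shift_sub_shift_le`). No Floquet theory enters: the constants come from coefficient
norms of `Δ` and are exponential in `q`.

For `J` in the exponential class, replacing `J` by `J_k` changes `M_t` by `O(t‖J - J_k‖)`. This is
negligible between the times `exp(η q_k / 2)` and `exp(η q_{k+1} / 2)`, while the first of these is
late enough to beat the exponential constants of period `q_k`. Summing over scales gives `Q` with a
rate on the `δ_n`, hence on `ℓ¹` (`exists_asymptotic_velocity`). If `Qφ = 0` with `φ ∈ ℓ¹`, the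
lower bounds force `‖S_{q_k}φ - S_{-q_k}φ‖ → 0`; as `φ` decays at infinity, `φ = 0`.

For the exponents, a Gronwall estimate with weights on the scale `t` bounds the `p`-th moment by `C
t^p`. Conversely `Qφ ≠ 0` makes the second moment of order `t²`, and interpolation against the norm
and the fourth moment gives `c t^p`. -/

noncomputable section

namespace JacobiDynamics

/-! ### Heisenberg evolution and time averages for a bounded Hamiltonian. -/

section Evolution

variable {E : Type*} [NormedAddCommGroup E] [InnerProductSpace ℂ E] [CompleteSpace E]

/-- The one-parameter group `e^{-itH}` generated by a bounded operator `H`. -/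
def evolution (H : E →L[ℂ] E) (t : ℝ) : E →L[ℂ] E :=
  NormedSpace.exp ((-(Complex.I * (t : ℂ))) • H)

theorem evolution_eq_exp_smul (H : E →L[ℂ] E) (t : ℝ) :
    evolution H t = NormedSpace.exp (t • ((-Complex.I) • H)) := by
  rw [evolution, ← Complex.coe_smul, smul_smul]
  congr 2
  ring

@[simp]
theorem evolution_zero (H : E →L[ℂ] E) : evolution H 0 = 1 := by
  simp [evolution]

theorem evolution_add (H : E →L[ℂ] E) (s t : ℝ) :
    evolution H (s + t) = evolution H s * evolution H t := by
  simp only [evolution_eq_exp_smul, add_smul]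
  let : NormedAlgebra ℚ (E →L[ℂ] E) := NormedAlgebra.restrictScalars ℚ ℂ _
  exact NormedSpace.exp_add_of_commute
    (((Commute.refl ((-Complex.I) • H)).smul_left s).smul_right t)

@[simp]
theorem evolution_neg_mul_self (H : E →L[ℂ] E) (t : ℝ) :
    evolution H (-t) * evolution H t = 1 := by
  rw [← evolution_add, neg_add_cancel, evolution_zero]

@[simp]
theorem evolution_mul_neg_self (H : E →L[ℂ] E) (t : ℝ) :
    evolution H t * evolution H (-t) = 1 := by
  rw [← evolution_add, add_neg_cancel, evolution_zero]

theorem evolution_neg_operator (H : E →L[ℂ] E) (t : ℝ) :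
    evolution (-H) t = evolution H (-t) := by
  simp [evolution]

theorem commute_evolution {H B : E →L[ℂ] E} (h : Commute B H) (t : ℝ) :
    Commute B (evolution H t) :=
  (h.smul_right _).exp_right

theorem star_evolution {H : E →L[ℂ] E} (hH : IsSelfAdjoint H) (t : ℝ) :
    star (evolution H t) = evolution H (-t) := by
  rw [evolution, evolution, NormedSpace.star_exp, star_smul, hH.star_eq]
  simp

theorem norm_evolution_apply {H : E →L[ℂ] E} (hH : IsSelfAdjoint H) (t : ℝ) (x : E) :
    ‖evolution H t x‖ = ‖x‖ := by
  have h : evolution H t ∈ unitary (E →L[ℂ] E) := by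
    rw [Unitary.mem_iff, star_evolution hH]
    simp
  exact ContinuousLinearMap.norm_map_of_mem_unitary h x

theorem norm_evolution_le {H : E →L[ℂ] E} (hH : IsSelfAdjoint H) (t : ℝ) :
    ‖evolution H t‖ ≤ 1 :=
  ContinuousLinearMap.opNorm_le_bound _ zero_le_one fun x => by
    rw [norm_evolution_apply hH, one_mul]

theorem hasDerivAt_evolution (H : E →L[ℂ] E) (t : ℝ) :
    HasDerivAt (evolution H) (evolution H t * ((-Complex.I) • H)) t := by
  have h := hasDerivAt_exp_smul_const (𝕂 := ℝ) ((-Complex.I) • H) t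
  have e : evolution H = fun u : ℝ => NormedSpace.exp (u • ((-Complex.I) • H)) :=
    funext fun u => evolution_eq_exp_smul H u
  rw [e]
  exact h

theorem hasDerivAt_evolution_neg (H : E →L[ℂ] E) (t : ℝ) :
    HasDerivAt (fun s => evolution H (-s)) (evolution H (-t) * (Complex.I • H)) t := by
  have e : (fun s => evolution H (-s)) = evolution (-H) :=
    funext fun s => (evolution_neg_operator H s).symm
  rw [e, ← evolution_neg_operator]
  exact (hasDerivAt_evolution (-H) t).congr_deriv (by simp)

theorem evolution_mul_comm (H : E →L[ℂ] E) (t : ℝ) :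
    evolution H t * H = H * evolution H t :=
  (commute_evolution (Commute.refl H) t).symm.eq

theorem evolution_mul_comm_assoc (H B : E →L[ℂ] E) (t : ℝ) :
    evolution H t * (H * B) = H * (evolution H t * B) := by
  rw [← mul_assoc, evolution_mul_comm, mul_assoc]

/-- The Heisenberg evolution `e^{isH} B e^{-isH}` of a bounded operator. -/
def conj (H B : E →L[ℂ] E) (s : ℝ) : E →L[ℂ] E :=
  evolution H (-s) * B * evolution H s

/-- `i[H, B]`. -/
def commI (H B : E →L[ℂ] E) : E →L[ℂ] E := Complex.I • (H * B - B * H)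

theorem hasDerivAt_conj (H B : E →L[ℂ] E) (s : ℝ) :
    HasDerivAt (conj H B) (conj H (commI H B) s) s := by
  have h := ((hasDerivAt_evolution_neg H s).mul_const B).mul (hasDerivAt_evolution H s)
  refine h.congr_deriv ?_
  simp only [conj, commI, mul_smul_comm, smul_mul_assoc, neg_smul, mul_neg, mul_sub, sub_mul,
    smul_sub, mul_assoc, evolution_mul_comm, evolution_mul_comm_assoc]
  abel

theorem continuous_conj (H B : E →L[ℂ] E) : Continuous (conj H B) :=
  continuous_iff_continuousAt.2 fun s => (hasDerivAt_conj H B s).continuousAt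

theorem norm_mul_evolution_le {H : E →L[ℂ] E} (hH : IsSelfAdjoint H) (B : E →L[ℂ] E) (s t : ℝ) :
    ‖evolution H s * B * evolution H t‖ ≤ ‖B‖ := by
  refine ContinuousLinearMap.opNorm_le_bound _ (norm_nonneg _) fun x => ?_
  change ‖evolution H s (B (evolution H t x))‖ ≤ _
  rw [norm_evolution_apply hH]
  exact (B.le_opNorm _).trans_eq (by rw [norm_evolution_apply hH])

theorem norm_conj_le {H : E →L[ℂ] E} (hH : IsSelfAdjoint H) (B : E →L[ℂ] E) (s : ℝ) :
    ‖conj H B s‖ ≤ ‖B‖ :=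
  norm_mul_evolution_le hH B _ _

theorem conj_mul_right {H C : E →L[ℂ] E} (hC : Commute C H) (B : E →L[ℂ] E) (s : ℝ) :
    conj H (B * C) s = conj H B s * C := by
  simp only [conj, mul_assoc, (commute_evolution hC s).eq]

theorem conj_mul_left {H C : E →L[ℂ] E} (hC : Commute C H) (B : E →L[ℂ] E) (s : ℝ) :
    conj H (C * B) s = C * conj H B s := by
  simp only [conj, ← mul_assoc, (commute_evolution hC (-s)).eq]

/-- The Cesàro mean `t⁻¹ ∫₀ᵗ e^{isH} B e^{-isH} ds`. -/
def timeAverage (H B : E →L[ℂ] E) (t : ℝ) : E →L[ℂ] E :=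
  (t⁻¹ : ℝ) • ∫ s in (0 : ℝ)..t, conj H B s

theorem intervalIntegrable_conj (H B : E →L[ℂ] E) (a b : ℝ) :
    IntervalIntegrable (conj H B) MeasureTheory.volume a b :=
  (continuous_conj H B).intervalIntegrable a b

theorem norm_inv_smul_integral_le {F : Type*} [NormedAddCommGroup F] [NormedSpace ℝ F]
    {f : ℝ → F} {C t : ℝ} (ht : 0 < t) (h : ∀ s ∈ Set.Icc 0 t, ‖f s‖ ≤ C) :
    ‖(t⁻¹ : ℝ) • ∫ s in (0 : ℝ)..t, f s‖ ≤ C := by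
  have h1 : ‖∫ s in (0 : ℝ)..t, f s‖ ≤ C * |t - 0| :=
    intervalIntegral.norm_integral_le_of_norm_le_const fun s hs => by
      rw [Set.uIoc_of_le ht.le] at hs
      exact h s ⟨hs.1.le, hs.2⟩
  rw [norm_smul, norm_inv, Real.norm_eq_abs, abs_of_pos ht]
  rw [sub_zero, abs_of_pos ht] at h1
  rw [inv_mul_le_iff₀ ht, mul_comm]
  exact h1

theorem norm_timeAverage_le {H : E →L[ℂ] E} (hH : IsSelfAdjoint H) (B : E →L[ℂ] E) {t : ℝ}
    (ht : 0 < t) : ‖timeAverage H B t‖ ≤ ‖B‖ :=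
  norm_inv_smul_integral_le ht fun s _ => norm_conj_le hH B s

theorem timeAverage_add (H B C : E →L[ℂ] E) (t : ℝ) :
    timeAverage H (B + C) t = timeAverage H B t + timeAverage H C t := by
  rw [timeAverage, timeAverage, timeAverage, ← smul_add, ← intervalIntegral.integral_add
    (intervalIntegrable_conj H B 0 t) (intervalIntegrable_conj H C 0 t)]
  simp only [conj, mul_add, add_mul]

theorem timeAverage_smul (H B : E →L[ℂ] E) (c : ℂ) (t : ℝ) :
    timeAverage H (c • B) t = c • timeAverage H B t := by
  rw [timeAverage, timeAverage, smul_comm c, ← intervalIntegral.integral_smul c]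
  congr 1
  simp only [conj, mul_smul_comm, smul_mul_assoc]

@[simp]
theorem timeAverage_zero (H : E →L[ℂ] E) (t : ℝ) : timeAverage H 0 t = 0 := by
  simp [timeAverage, conj]

theorem timeAverage_mul_right {H C : E →L[ℂ] E} (hC : Commute C H) (B : E →L[ℂ] E) (t : ℝ) :
    timeAverage H (B * C) t = timeAverage H B t * C := by
  simp only [timeAverage, conj_mul_right hC, smul_mul_assoc]
  congr 1
  exact ((ContinuousLinearMap.mul ℝ (E →L[ℂ] E)).flip C).intervalIntegral_comp_comm
    (intervalIntegrable_conj H B 0 t)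

theorem timeAverage_mul_left {H C : E →L[ℂ] E} (hC : Commute C H) (B : E →L[ℂ] E) (t : ℝ) :
    timeAverage H (C * B) t = C * timeAverage H B t := by
  simp only [timeAverage, conj_mul_left hC, mul_smul_comm]
  congr 1
  exact (ContinuousLinearMap.mul ℝ (E →L[ℂ] E) C).intervalIntegral_comp_comm
    (intervalIntegrable_conj H B 0 t)

theorem timeAverage_of_commute {H C : E →L[ℂ] E} (hC : Commute C H) {t : ℝ} (ht : 0 < t) :
    timeAverage H C t = C := by
  have h : ∀ s, conj H C s = C := fun s => by
    rw [← mul_one C, conj_mul_left hC, conj, mul_one, evolution_neg_mul_self]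
  simp only [timeAverage, h, intervalIntegral.integral_const, sub_zero]
  rw [smul_smul, inv_mul_cancel₀ ht.ne', one_smul]

theorem integral_conj_commI (H B : E →L[ℂ] E) (t : ℝ) :
    ∫ s in (0 : ℝ)..t, conj H (commI H B) s = conj H B t - B := by
  rw [intervalIntegral.integral_eq_sub_of_hasDerivAt (fun s _ => hasDerivAt_conj H B s)
    (intervalIntegrable_conj H _ 0 t)]
  simp [conj]

/-- Commuting with `H` passes inside the average, where it produces an exact derivative; only the
boundary terms survive. This is the source of every `O(1/t)` below. -/
theorem commI_timeAverage (H B : E →L[ℂ] E) (t : ℝ) :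
    commI H (timeAverage H B t) = (t⁻¹ : ℝ) • (conj H B t - B) := by
  have h : timeAverage H (commI H B) t = commI H (timeAverage H B t) := by
    rw [commI, timeAverage_smul, sub_eq_add_neg, timeAverage_add, ← neg_one_smul ℂ,
      timeAverage_smul, timeAverage_mul_left (Commute.refl H),
      timeAverage_mul_right (Commute.refl H), commI, neg_one_smul, ← sub_eq_add_neg]
  rw [← h, timeAverage, integral_conj_commI]

theorem norm_commutator_timeAverage_le {H : E →L[ℂ] E} (hH : IsSelfAdjoint H) (B : E →L[ℂ] E)
    {t : ℝ} (ht : 0 < t) :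
    ‖H * timeAverage H B t - timeAverage H B t * H‖ ≤ 2 * ‖B‖ / t := by
  have h1 : ‖H * timeAverage H B t - timeAverage H B t * H‖ = ‖commI H (timeAverage H B t)‖ := by
    rw [commI, norm_smul, Complex.norm_I, one_mul]
  rw [h1, commI_timeAverage, norm_smul, norm_inv, Real.norm_eq_abs, abs_of_pos ht, div_eq_inv_mul]
  gcongr
  calc ‖conj H B t - B‖ ≤ ‖conj H B t‖ + ‖B‖ := norm_sub_le _ _
    _ ≤ 2 * ‖B‖ := by linarith [norm_conj_le hH B t]

theorem isSelfAdjoint_timeAverage {H B : E →L[ℂ] E} (hH : IsSelfAdjoint H) (hB : IsSelfAdjoint B) (t : ℝ) :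
    IsSelfAdjoint (timeAverage H B t) := by
  have hc : ∀ s, star (conj H B s) = conj H B s := fun s => by
    simp only [conj, star_mul, star_evolution hH, hB.star_eq, neg_neg, mul_assoc]
  have h := (starL' ℝ : (E →L[ℂ] E) ≃L[ℝ] (E →L[ℂ] E)).toContinuousLinearMap
    |>.intervalIntegral_comp_comm (intervalIntegrable_conj H B 0 t)
  simp only [ContinuousLinearEquiv.coe_coe, starL'_apply, hc] at h
  rw [IsSelfAdjoint, timeAverage, star_smul, ← h]
  simp

/-- Duhamel: the derivative of `e^{isH} e^{-isH'}` has norm at most `‖H' - H‖`. -/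
theorem norm_evolution_sub_le {H H' : E →L[ℂ] E} (hH : IsSelfAdjoint H) (hH' : IsSelfAdjoint H')
    {t : ℝ} (ht : 0 ≤ t) : ‖evolution H' t - evolution H t‖ ≤ t * ‖H' - H‖ := by
  have hd : ∀ s : ℝ, HasDerivAt (fun s => evolution H (-s) * evolution H' s)
      (evolution H (-s) * (Complex.I • (H - H')) * evolution H' s) s := fun s => by
    have h := (hasDerivAt_evolution_neg H s).mul (hasDerivAt_evolution H' s)
    refine h.congr_deriv ?_
    simp only [mul_smul_comm, smul_mul_assoc, neg_smul, mul_neg, mul_sub, sub_mul,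
      smul_sub, mul_assoc, evolution_mul_comm]
    abel
  have hb : ∀ s : ℝ, ‖evolution H (-s) * (Complex.I • (H - H')) * evolution H' s‖ ≤ ‖H' - H‖ := by
    intro s
    refine ContinuousLinearMap.opNorm_le_bound _ (norm_nonneg _) fun x => ?_
    change ‖evolution H (-s) (Complex.I • (H - H') (evolution H' s x))‖ ≤ _
    rw [norm_evolution_apply hH, norm_smul, Complex.norm_I, one_mul, norm_sub_rev H' H]
    exact ((H - H').le_opNorm _).trans_eq (by rw [norm_evolution_apply hH'])
  have h := norm_image_sub_le_of_norm_deriv_le_segment'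
    (f := fun s => evolution H (-s) * evolution H' s) (a := 0) (b := t) (fun s _ => (hd s).hasDerivWithinAt) (fun s _ => hb s) t ⟨ht, le_rfl⟩
  simp only [neg_zero, evolution_zero, mul_one, sub_zero] at h
  have e : evolution H' t - evolution H t
      = evolution H t * (evolution H (-t) * evolution H' t - 1) := by
    rw [mul_sub, ← mul_assoc, evolution_mul_neg_self, one_mul, mul_one]
  rw [e, mul_comm t]
  refine (norm_mul_le _ _).trans (le_trans ?_ h)
  exact mul_le_of_le_one_left (norm_nonneg _) (norm_evolution_le hH t)

theorem norm_conj_sub_le {H H' : E →L[ℂ] E} (hH : IsSelfAdjoint H) (hH' : IsSelfAdjoint H')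
    (B B' : E →L[ℂ] E) {s : ℝ} (hs : 0 ≤ s) :
    ‖conj H' B' s - conj H B s‖ ≤ ‖B' - B‖ + 2 * s * ‖B‖ * ‖H' - H‖ := by
  have hU := norm_evolution_sub_le hH hH' hs
  have hU' : ‖evolution H' (-s) - evolution H (-s)‖ ≤ s * ‖H' - H‖ := by
    rw [← star_evolution hH', ← star_evolution hH, ← star_sub, norm_star]
    exact hU
  have e : conj H' B' s - conj H B s = conj H' (B' - B) s
      + (evolution H' (-s) - evolution H (-s)) * (B * evolution H' s)
      + evolution H (-s) * B * (evolution H' s - evolution H s) := by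
    simp only [conj]
    noncomm_ring
  rw [e]
  refine (norm_add₃_le).trans ?_
  have h1 := norm_conj_le hH' (B' - B) s
  have h2 : ‖(evolution H' (-s) - evolution H (-s)) * (B * evolution H' s)‖
      ≤ s * ‖H' - H‖ * ‖B‖ := by
    refine (norm_mul_le _ _).trans (mul_le_mul hU' ?_ (norm_nonneg _) (by positivity))
    exact (norm_mul_le _ _).trans
      (mul_le_of_le_one_right (norm_nonneg _) (norm_evolution_le hH' s))
  have h3 : ‖evolution H (-s) * B * (evolution H' s - evolution H s)‖
      ≤ ‖B‖ * (s * ‖H' - H‖) := by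
    refine (norm_mul_le _ _).trans (mul_le_mul ?_ hU (norm_nonneg _) (norm_nonneg _))
    exact (norm_mul_le _ _).trans
      (mul_le_of_le_one_left (norm_nonneg _) (norm_evolution_le hH (-s)))
  linarith

/-- The loss linear in `t` is what the exponential approximation rate has to beat on each time
window. -/
theorem norm_timeAverage_sub_le {H H' : E →L[ℂ] E} (hH : IsSelfAdjoint H)
    (hH' : IsSelfAdjoint H') (B B' : E →L[ℂ] E) {t : ℝ} (ht : 0 < t) :
    ‖timeAverage H' B' t - timeAverage H B t‖ ≤ ‖B' - B‖ + 2 * t * ‖B‖ * ‖H' - H‖ := by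
  rw [timeAverage, timeAverage, ← smul_sub, ← intervalIntegral.integral_sub
    (intervalIntegrable_conj H' B' 0 t) (intervalIntegrable_conj H B 0 t)]
  refine norm_inv_smul_integral_le ht fun s hs => (norm_conj_sub_le hH hH' B B' hs.1).trans ?_
  have := hs.2
  gcongr

/-- If `‖[H, W]x‖ ≤ κ‖Wx‖` for all `x`, then `‖W e^{-itH} x‖` grows at most like `e^{κt}`. -/
theorem norm_apply_evolution_le {H W : E →L[ℂ] E} (hH : IsSelfAdjoint H) {κ : ℝ}
    (hκ : ∀ x, ‖(H * W - W * H) x‖ ≤ κ * ‖W x‖) (x : E) (t : ℝ) :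
    ‖W (evolution H t x)‖ ≤ ‖W x‖ * Real.exp (κ * |t|) := by
  wlog ht : 0 ≤ t generalizing H t
  · have hκ' : ∀ x, ‖((-H) * W - W * (-H)) x‖ ≤ κ * ‖W x‖ := fun x => by
      have e : (-H) * W - W * (-H) = -(H * W - W * H) := by noncomm_ring
      rw [e, neg_apply, norm_neg]
      exact hκ x
    have h := this (H := -H) hH.neg hκ' (-t) (by linarith)
    rwa [evolution_neg_operator, neg_neg, abs_neg] at h
  have hn : ∀ s, ‖conj H W s x‖ = ‖W (evolution H s x)‖ := fun s => by
    change ‖evolution H (-s) (W (evolution H s x))‖ = _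
    rw [norm_evolution_apply hH]
  have hd : ∀ s, HasDerivAt (fun s => conj H W s x) (conj H (commI H W) s x) s := fun s =>
    (((ContinuousLinearMap.apply ℂ E x).restrictScalars ℝ).hasFDerivAt.comp_hasDerivAt s
      (hasDerivAt_conj H W s))
  have hb : ∀ s, ‖conj H (commI H W) s x‖ ≤ κ * ‖conj H W s x‖ + 0 := fun s => by
    rw [hn, add_zero]
    change ‖evolution H (-s) (Complex.I • (H * W - W * H) (evolution H s x))‖ ≤ _
    rw [norm_evolution_apply hH, norm_smul, Complex.norm_I, one_mul]
    exact hκ _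
  have h := norm_le_gronwallBound_of_norm_deriv_right_le (f := fun s => conj H W s x)
    (f' := fun s => conj H (commI H W) s x) (δ := ‖W x‖) (K := κ) (ε := 0) (a := 0) (b := t)
    (fun s _ => (hd s).continuousAt.continuousWithinAt) (fun s _ => (hd s).hasDerivWithinAt)
    (by rw [hn, evolution_zero]; rfl) (fun s _ => hb s) t ⟨ht, le_rfl⟩
  rw [abs_of_nonneg ht]
  rwa [hn, gronwallBound_ε0, sub_zero] at h

end Evolution

end JacobiDynamics

namespace JacobiDynamics

open Polynomial

/-! ### Weighted coefficient norms of polynomials. -/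

section PolyNorm

/-- The weighted `ℓ¹` norm `∑ |c_m| r^m` of the coefficients of a polynomial. -/
def polyNorm (r : ℝ) (p : ℂ[X]) : ℝ :=
  p.sum fun m c => ‖c‖ * r ^ m

theorem polyNorm_eq_sum_range (r : ℝ) (p : ℂ[X]) {N : ℕ} (hN : p.natDegree < N) :
    polyNorm r p = ∑ m ∈ Finset.range N, ‖p.coeff m‖ * r ^ m :=
  p.sum_over_range' (by simp) N hN

theorem polyNorm_nonneg {r : ℝ} (hr : 0 ≤ r) (p : ℂ[X]) : 0 ≤ polyNorm r p :=
  Finset.sum_nonneg fun _ _ => by positivity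

theorem polyNorm_add_le {r : ℝ} (hr : 0 ≤ r) (p q : ℂ[X]) :
    polyNorm r (p + q) ≤ polyNorm r p + polyNorm r q := by
  have hN : (p + q).natDegree < max p.natDegree q.natDegree + 1 :=
    Nat.lt_succ_of_le (natDegree_add_le p q)
  rw [polyNorm_eq_sum_range r _ hN,
    polyNorm_eq_sum_range r p (Nat.lt_succ_of_le (le_max_left _ q.natDegree)),
    polyNorm_eq_sum_range r q (Nat.lt_succ_of_le (le_max_right p.natDegree _)),
    ← Finset.sum_add_distrib]
  refine Finset.sum_le_sum fun m _ => ?_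
  rw [coeff_add, ← add_mul]
  gcongr
  exact norm_add_le _ _

theorem polyNorm_C_mul (r : ℝ) (a : ℂ) (p : ℂ[X]) :
    polyNorm r (C a * p) = ‖a‖ * polyNorm r p := by
  rw [polyNorm_eq_sum_range r _ (Nat.lt_succ_of_le (natDegree_C_mul_le a p)),
    polyNorm_eq_sum_range r p (Nat.lt_succ_self _), Finset.mul_sum]
  simp [mul_assoc]

theorem polyNorm_X_mul (r : ℝ) (p : ℂ[X]) : polyNorm r (X * p) = r * polyNorm r p := by
  have hN : (X * p).natDegree < p.natDegree + 1 + 1 :=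
    Nat.lt_succ_of_le ((natDegree_mul_le).trans (by rw [natDegree_X, add_comm]))
  rw [polyNorm_eq_sum_range r _ hN, polyNorm_eq_sum_range r p (Nat.lt_succ_self _),
    Finset.sum_range_succ', Finset.mul_sum]
  simp only [coeff_X_mul, coeff_X_mul_zero, norm_zero, zero_mul, add_zero]
  exact Finset.sum_congr rfl fun m _ => by ring

@[simp]
theorem polyNorm_one (r : ℝ) : polyNorm r 1 = 1 := by
  rw [polyNorm_eq_sum_range r 1 (N := 1) (by simp)]
  simp

@[simp]
theorem polyNorm_zero (r : ℝ) : polyNorm r 0 = 0 := by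
  simp [polyNorm]

theorem norm_sum_smul_le {F : Type*} [NormedAddCommGroup F] [NormedSpace ℂ F] {r c : ℝ}
    (p : ℂ[X]) (f : ℕ → F) (hf : ∀ m, ‖f m‖ ≤ c * r ^ m) :
    ‖p.sum fun m a => a • f m‖ ≤ c * polyNorm r p := by
  rw [polyNorm, Polynomial.sum, Polynomial.sum, Finset.mul_sum]
  refine (norm_sum_le _ _).trans (Finset.sum_le_sum fun m _ => ?_)
  rw [norm_smul, mul_left_comm]
  exact mul_le_mul_of_nonneg_left (hf m) (norm_nonneg _)

end PolyNorm

/-! ### The derivation `i[·, X]` on polynomials in `H`, and its time averages. -/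

section Derivation

variable {E : Type*} [NormedAddCommGroup E] [InnerProductSpace ℂ E] [CompleteSpace E]

/-- If `A = i[H, X]` then `powComm H A m = i[H^m, X]`, by the Leibniz rule. -/
def powComm (H A : E →L[ℂ] E) : ℕ → E →L[ℂ] E
  | 0 => 0
  | m + 1 => powComm H A m * H + H ^ m * A

/-- If `A = i[H, X]` then `polyComm H A p = i[p(H), X]`. -/
def polyComm (H A : E →L[ℂ] E) (p : ℂ[X]) : E →L[ℂ] E :=
  p.sum fun m c => c • powComm H A m

theorem norm_pow_le_pow {H : E →L[ℂ] E} {r : ℝ} (hH : ‖H‖ ≤ r) (m : ℕ) : ‖H ^ m‖ ≤ r ^ m := by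
  have hr : 0 ≤ r := (norm_nonneg _).trans hH
  induction m with
  | zero => rw [pow_zero, pow_zero]; exact ContinuousLinearMap.norm_id_le
  | succ m ih =>
    rw [pow_succ, pow_succ]
    exact (norm_mul_le _ _).trans (mul_le_mul ih hH (norm_nonneg _) (by positivity))

theorem norm_pow_commutator_le {H M : E →L[ℂ] E} {r c : ℝ} (hr : 1 ≤ r) (hH : ‖H‖ ≤ r)
    (hM : ‖H * M - M * H‖ ≤ c) (m : ℕ) : ‖H ^ m * M - M * H ^ m‖ ≤ m * r ^ m * c := by
  have hc : 0 ≤ c := (norm_nonneg _).trans hM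
  induction m with
  | zero => simp
  | succ m ih =>
    have e : H ^ (m + 1) * M - M * H ^ (m + 1)
        = H ^ m * (H * M - M * H) + (H ^ m * M - M * H ^ m) * H := by
      rw [pow_succ]; noncomm_ring
    rw [e]
    refine (norm_add_le _ _).trans ?_
    have h1 : ‖H ^ m * (H * M - M * H)‖ ≤ r ^ m * c :=
      (norm_mul_le _ _).trans
        (mul_le_mul (norm_pow_le_pow hH m) hM (norm_nonneg _) (by positivity))
    have h2 : ‖(H ^ m * M - M * H ^ m) * H‖ ≤ m * r ^ m * c * r :=
      (norm_mul_le _ _).trans (mul_le_mul ih hH (norm_nonneg _) (by positivity))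
    have h3 : r ^ m * c ≤ r ^ (m + 1) * c := by
      gcongr
      omega
    push_cast
    calc _ ≤ r ^ (m + 1) * c + m * r ^ m * c * r := by linarith
      _ = _ := by ring

/-- Powers of `H` pull out of a time average exactly, so each Leibniz step contributes `H^m M`.
Moving `M` to the left costs `[H^m, M]`, which is `O(m r^m / t)`; adding these up gives the factor
`m²`. -/
theorem norm_timeAverage_powComm_sub_le {H A : E →L[ℂ] E} (hH : IsSelfAdjoint H) {r t : ℝ}
    (hr : 1 ≤ r) (hHr : ‖H‖ ≤ r) (ht : 0 < t) (m : ℕ) :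
    ‖timeAverage H (powComm H A m) t - (m : ℂ) • (timeAverage H A t * H ^ (m - 1))‖
      ≤ (m : ℝ) ^ 2 * r ^ m * (2 * ‖A‖ / t) := by
  set M := timeAverage H A t
  have hM := norm_commutator_timeAverage_le hH A ht
  have hc : 0 ≤ 2 * ‖A‖ / t := by positivity
  generalize 2 * ‖A‖ / t = c at *
  induction m with
  | zero => simp [powComm]
  | succ m ih =>
    -- At `m = 0` the truncated exponent `m - 1` is harmless because the coefficient `m` vanishes.
    have hpow : (m : ℂ) • (M * H ^ (m - 1)) * H = (m : ℂ) • (M * H ^ m) := by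
      rcases m with - | m
      · simp
      · rw [smul_mul_assoc, mul_assoc, Nat.add_sub_cancel, ← pow_succ]
    have e : timeAverage H (powComm H A (m + 1)) t
          - ((m + 1 : ℕ) : ℂ) • (M * H ^ (m + 1 - 1))
        = (timeAverage H (powComm H A m) t - (m : ℂ) • (M * H ^ (m - 1))) * H
          + (H ^ m * M - M * H ^ m) := by
      rw [powComm, timeAverage_add, timeAverage_mul_right (Commute.refl H),
        timeAverage_mul_left ((Commute.refl H).pow_left m), sub_mul, hpow, Nat.add_sub_cancel]
      push_cast
      rw [add_smul, one_smul]
      abel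
    rw [e]
    refine (norm_add_le _ _).trans ?_
    have h1 := norm_pow_commutator_le hr hHr hM m
    have h2 : ‖(timeAverage H (powComm H A m) t - (m : ℂ) • (M * H ^ (m - 1))) * H‖
        ≤ (m : ℝ) ^ 2 * r ^ m * c * r :=
      (norm_mul_le _ _).trans (mul_le_mul ih hHr (norm_nonneg _) (by positivity))
    have h3 : (m : ℝ) * r ^ m * c ≤ m * r ^ (m + 1) * c := by
      gcongr
      omega
    have h4 : 0 ≤ ((m : ℝ) + 1) * r ^ (m + 1) * c := by positivity
    push_cast
    have e2 : (m : ℝ) ^ 2 * r ^ m * c * r = m ^ 2 * r ^ (m + 1) * c := by ring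
    have h5 : 0 ≤ (m : ℝ) * r ^ (m + 1) * c := by positivity
    have e3 : ((m : ℝ) + 1) ^ 2 * r ^ (m + 1) * c = m ^ 2 * r ^ (m + 1) * c
        + m * r ^ (m + 1) * c + (m + 1) * r ^ (m + 1) * c := by ring
    linarith

theorem norm_timeAverage_powComm_sub_le' {H A : E →L[ℂ] E} (hH : IsSelfAdjoint H) {r t : ℝ}
    (hr : 1 ≤ r) (hHr : ‖H‖ ≤ r) (ht : 0 < t) (m : ℕ) :
    ‖timeAverage H (powComm H A m) t - (m : ℂ) • (H ^ (m - 1) * timeAverage H A t)‖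
      ≤ 2 * (m : ℝ) ^ 2 * r ^ m * (2 * ‖A‖ / t) := by
  have h1 := norm_timeAverage_powComm_sub_le (A := A) hH hr hHr ht m
  have h2 := norm_pow_commutator_le hr hHr (norm_commutator_timeAverage_le hH A ht) (m - 1)
  have hc : 0 ≤ 2 * ‖A‖ / t := by positivity
  set M := timeAverage H A t
  generalize 2 * ‖A‖ / t = c at *
  have e : timeAverage H (powComm H A m) t - (m : ℂ) • (H ^ (m - 1) * M)
      = (timeAverage H (powComm H A m) t - (m : ℂ) • (M * H ^ (m - 1)))
        - (m : ℂ) • (H ^ (m - 1) * M - M * H ^ (m - 1)) := by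
    rw [smul_sub]; abel
  have h3 : ((m - 1 : ℕ) : ℝ) * r ^ (m - 1) * c ≤ m * r ^ m * c := by
    gcongr
    · exact Nat.sub_le _ _
    · exact Nat.sub_le _ _
  rw [e]
  refine (norm_sub_le _ _).trans ?_
  rw [norm_smul, Complex.norm_natCast]
  have h4 := mul_le_mul_of_nonneg_left (h2.trans h3) (Nat.cast_nonneg (α := ℝ) m)
  linarith

/-- Absorbs the polynomial losses in the degree by enlarging the radius, which is why `polyNorm` is
taken at `4 * r` throughout. -/
theorem sq_mul_pow_le {r : ℝ} (hr : 0 ≤ r) (m : ℕ) : (m : ℝ) ^ 2 * r ^ m ≤ (4 * r) ^ m := by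
  have h : (m : ℝ) ≤ 2 ^ m := by exact_mod_cast Nat.lt_two_pow_self.le
  have h2 : (m : ℝ) ^ 2 ≤ 4 ^ m := by
    calc (m : ℝ) ^ 2 ≤ (2 ^ m) ^ 2 := by gcongr
      _ = 4 ^ m := by rw [← pow_mul, mul_comm, pow_mul]; norm_num
  rw [mul_pow]
  gcongr

theorem timeAverage_polyComm (H A : E →L[ℂ] E) (p : ℂ[X]) (t : ℝ) :
    timeAverage H (polyComm H A p) t = p.sum fun m c => c • timeAverage H (powComm H A m) t := by
  have h : ∀ s : Finset ℕ, timeAverage H (∑ m ∈ s, p.coeff m • powComm H A m) t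
      = ∑ m ∈ s, p.coeff m • timeAverage H (powComm H A m) t := fun s => by
    induction s using Finset.induction_on with
    | empty => simp
    | insert a s ha ih =>
      rw [Finset.sum_insert ha, Finset.sum_insert ha, timeAverage_add, timeAverage_smul, ih]
  exact h _

theorem aeval_derivative_eq_sum (H : E →L[ℂ] E) (p : ℂ[X]) :
    aeval H (derivative p) = p.sum fun m c => c • ((m : ℂ) • H ^ (m - 1)) := by
  rw [derivative_apply, Polynomial.sum, Polynomial.sum, map_sum]
  refine Finset.sum_congr rfl fun m _ => ?_
  rw [map_mul, aeval_C, map_pow, aeval_X, ← Algebra.smul_def, smul_smul]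

theorem norm_aeval_derivative_le {H : E →L[ℂ] E} {r : ℝ} (hr : 1 ≤ r) (hHr : ‖H‖ ≤ r)
    (p : ℂ[X]) : ‖aeval H (derivative p)‖ ≤ polyNorm (4 * r) p := by
  rw [aeval_derivative_eq_sum, ← one_mul (polyNorm _ _)]
  refine norm_sum_smul_le p _ fun m => ?_
  rw [one_mul, norm_smul, Complex.norm_natCast]
  refine le_trans ?_ (sq_mul_pow_le (by linarith) m)
  have h := norm_pow_le_pow hHr (m - 1)
  have h2 : r ^ (m - 1) ≤ r ^ m := pow_le_pow_right₀ hr (Nat.sub_le _ _)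
  have h3 : (m : ℝ) ≤ (m : ℝ) ^ 2 := by exact_mod_cast Nat.le_self_pow two_ne_zero m
  exact mul_le_mul h3 (h.trans h2) (norm_nonneg _) (by positivity)

/-- In the time average, `i[p(H), X]` is asymptotically `i[H, X] p'(H)`. -/
theorem norm_timeAverage_polyComm_sub_le {H A : E →L[ℂ] E} (hH : IsSelfAdjoint H) {r t : ℝ}
    (hr : 1 ≤ r) (hHr : ‖H‖ ≤ r) (ht : 0 < t) (p : ℂ[X]) :
    ‖timeAverage H (polyComm H A p) t - timeAverage H A t * aeval H (derivative p)‖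
      ≤ 4 * ‖A‖ / t * polyNorm (4 * r) p := by
  rw [timeAverage_polyComm, aeval_derivative_eq_sum, Polynomial.sum, Polynomial.sum,
    Finset.mul_sum, ← Finset.sum_sub_distrib]
  simp only [mul_smul_comm, ← smul_sub]
  refine norm_sum_smul_le p (fun m => timeAverage H (powComm H A m) t
    - (m : ℂ) • (timeAverage H A t * H ^ (m - 1))) fun m => ?_
  refine (norm_timeAverage_powComm_sub_le hH hr hHr ht m).trans ?_
  have h := mul_le_mul_of_nonneg_right (sq_mul_pow_le (zero_le_one.trans hr) m)
    (by positivity : 0 ≤ 2 * ‖A‖ / t)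
  have h2 : 0 ≤ 2 * ‖A‖ / t * (4 * r) ^ m := by positivity
  have e : 4 * ‖A‖ / t * (4 * r) ^ m = 2 * (2 * ‖A‖ / t * (4 * r) ^ m) := by ring
  linarith

theorem norm_timeAverage_polyComm_sub_le' {H A : E →L[ℂ] E} (hH : IsSelfAdjoint H) {r t : ℝ}
    (hr : 1 ≤ r) (hHr : ‖H‖ ≤ r) (ht : 0 < t) (p : ℂ[X]) :
    ‖timeAverage H (polyComm H A p) t - aeval H (derivative p) * timeAverage H A t‖
      ≤ 4 * ‖A‖ / t * polyNorm (4 * r) p := by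
  rw [timeAverage_polyComm, aeval_derivative_eq_sum, Polynomial.sum, Polynomial.sum,
    Finset.sum_mul, ← Finset.sum_sub_distrib]
  simp only [smul_mul_assoc, ← smul_sub]
  refine norm_sum_smul_le p (fun m => timeAverage H (powComm H A m) t
    - (m : ℂ) • (H ^ (m - 1) * timeAverage H A t)) fun m => ?_
  refine (norm_timeAverage_powComm_sub_le' hH hr hHr ht m).trans ?_
  have h := mul_le_mul_of_nonneg_right (sq_mul_pow_le (zero_le_one.trans hr) m)
    (by positivity : 0 ≤ 2 * ‖A‖ / t)
  have e : 4 * ‖A‖ / t * (4 * r) ^ m = 2 * (2 * ‖A‖ / t * (4 * r) ^ m) := by ring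
  linarith

/-- The time averages of `A = i[H, X]` at two times almost agree on the range of
`K = i[p(H), X]`, if `K` commutes with `H` and `A`. -/
theorem norm_timeAverage_sub_mul_le {H A K : E →L[ℂ] E} (hH : IsSelfAdjoint H) {r τ s t : ℝ}
    (hr : 1 ≤ r) (hHr : ‖H‖ ≤ r) (hτ : 0 < τ) (hs : τ ≤ s) (ht : τ ≤ t) {p : ℂ[X]}
    (hK : polyComm H A p = K) (hKH : Commute K H) (hKA : Commute K A) :
    ‖(timeAverage H A t - timeAverage H A s) * K‖
      ≤ 8 * ‖A‖ ^ 2 / τ * polyNorm (4 * r) p := by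
  have h1 := norm_timeAverage_polyComm_sub_le (A := A) hH hr hHr (hτ.trans_le ht) p
  have h2 := norm_timeAverage_polyComm_sub_le' (A := A) hH hr hHr (hτ.trans_le hs) p
  rw [hK, timeAverage_of_commute hKH (hτ.trans_le ht)] at h1
  rw [hK, timeAverage_of_commute hKH (hτ.trans_le hs)] at h2
  have hMs := norm_timeAverage_le hH A (hτ.trans_le hs)
  have hMt := norm_timeAverage_le hH A (hτ.trans_le ht)
  have hcomm : timeAverage H A s * K = K * timeAverage H A s := by
    rw [← timeAverage_mul_right hKH, ← timeAverage_mul_left hKH, hKA.eq]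
  have hB := polyNorm_nonneg (by linarith : (0 : ℝ) ≤ 4 * r) p
  have h1' := h1.trans (b := 4 * ‖A‖ / t * polyNorm (4 * r) p)
    (c := 4 * ‖A‖ / τ * polyNorm (4 * r) p) (by gcongr)
  have h2' := h2.trans (b := 4 * ‖A‖ / s * polyNorm (4 * r) p)
    (c := 4 * ‖A‖ / τ * polyNorm (4 * r) p) (by gcongr)
  set Ms := timeAverage H A s
  set Mt := timeAverage H A t
  set P := aeval H (derivative p)
  -- Insert `Mt * P * Ms`: `K` is close to `P * Ms` at time `s` and to `Mt * P` at time `t`. `hcomm`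
  -- lets `Ms * K` be read as `K * Ms`.
  have e : (Mt - Ms) * K = Mt * (K - P * Ms) - (K - Mt * P) * Ms := by
    rw [sub_mul, hcomm]; noncomm_ring
  rw [e]
  refine (norm_sub_le _ _).trans ?_
  have h3 := (norm_mul_le Mt (K - P * Ms)).trans
    (mul_le_mul hMt h2' (norm_nonneg _) (norm_nonneg _))
  have h4 := (norm_mul_le (K - Mt * P) Ms).trans
    (mul_le_mul h1' hMs (norm_nonneg _) (by positivity))
  refine (add_le_add h3 h4).trans_eq ?_
  ring

/-- Since `K = p'(H) M_t + O(1/t)` with `p'(H)` bounded, a vector nearly annihilated by the mean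
velocity is nearly annihilated by `K`. -/
theorem norm_apply_le_timeAverage {H A K : E →L[ℂ] E} (hH : IsSelfAdjoint H) {r t : ℝ}
    (hr : 1 ≤ r) (hHr : ‖H‖ ≤ r) (ht : 0 < t) {p : ℂ[X]}
    (hK : polyComm H A p = K) (hKH : Commute K H) (x : E) :
    ‖K x‖ ≤ polyNorm (4 * r) p * (‖timeAverage H A t x‖ + 4 * ‖A‖ / t * ‖x‖) := by
  have h := norm_timeAverage_polyComm_sub_le' (A := A) hH hr hHr ht p
  rw [hK, timeAverage_of_commute hKH ht] at h
  have hP := norm_aeval_derivative_le hr hHr p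
  have e : K x = aeval H (derivative p) (timeAverage H A t x)
      + (K - aeval H (derivative p) * timeAverage H A t) x := by
    simp
  rw [e]
  refine (norm_add_le _ _).trans ?_
  have h1 := (ContinuousLinearMap.le_opNorm (aeval H (derivative p)) (timeAverage H A t x)).trans
    (mul_le_mul_of_nonneg_right hP (norm_nonneg _))
  have h2 := (ContinuousLinearMap.le_opNorm _ x).trans
    (mul_le_mul_of_nonneg_right h (norm_nonneg x))
  refine (add_le_add h1 h2).trans_eq ?_
  ring

end Derivation

end JacobiDynamics

namespace JacobiDynamics

open Polynomial

/-! ### Basis vectors, weighted shifts and translations. -/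

section Shifts

/-- The standard basis vector `δ_n`. -/
def delta (n : ℤ) : L2Z := lp.single 2 n 1

theorem delta_apply (n m : ℤ) : delta n m = if m = n then 1 else 0 := by
  rw [delta, lp.single_apply, Pi.single_apply]

@[simp]
theorem norm_delta (n : ℤ) : ‖delta n‖ = 1 := by
  rw [delta, lp.norm_single (by norm_num), norm_one]

theorem clm_ext_delta {S T : L2Z →L[ℂ] L2Z} (h : ∀ n, S (delta n) = T (delta n)) : S = T := by
  refine lp.ext_continuousLinearMap (ENNReal.ofNat_ne_top (n := nat_lit 2)) fun n => ?_
  exact ContinuousLinearMap.ext_ring (h n)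

@[simp]
theorem weightedShift_apply (c : ℤ → ℝ) (hc : ∃ C, ∀ n, |c n| ≤ C) (k : ℤ) (φ : L2Z) (n : ℤ) :
    weightedShift c hc k φ n = (c n : ℂ) * φ (n + k) := rfl

theorem weightedShift_delta (c : ℤ → ℝ) (hc : ∃ C, ∀ n, |c n| ≤ C) (k m : ℤ) :
    weightedShift c hc k (delta m) = (c (m - k) : ℂ) • delta (m - k) := by
  ext n
  rw [weightedShift_apply, lp.coeFn_smul, Pi.smul_apply, smul_eq_mul, delta_apply, delta_apply]
  by_cases h : n + k = m
  · have h' : n = m - k := by omega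
    simp [h']
  · have h' : n ≠ m - k := by omega
    simp [h, h']

theorem norm_weightedShift_le {c : ℤ → ℝ} (hc : ∃ C, ∀ n, |c n| ≤ C) (k : ℤ) {C : ℝ}
    (hC : ∀ n, |c n| ≤ C) : ‖weightedShift c hc k‖ ≤ C :=
  ContinuousLinearMap.opNorm_le_bound _ ((abs_nonneg _).trans (hC 0)) fun φ =>
    lp.norm_le_of_forall_sum_le (by norm_num)
      (mul_nonneg ((abs_nonneg _).trans (hC 0)) (norm_nonneg _))
      (weightedShift_aux c k C hC φ)

theorem star_weightedShift {c : ℤ → ℝ} (hc : ∃ C, ∀ n, |c n| ≤ C) (k : ℤ) :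
    star (weightedShift c hc k)
      = weightedShift (fun n => c (n - k)) (hc.imp fun _ h n => h (n - k)) (-k) := by
  rw [ContinuousLinearMap.star_eq_adjoint]
  refine ((ContinuousLinearMap.eq_adjoint_iff _ _).2 fun φ ψ => ?_).symm
  rw [lp.inner_eq_tsum, lp.inner_eq_tsum, ← (Equiv.addRight k).tsum_eq]
  refine tsum_congr fun n => ?_
  simp
  ring

theorem commute_weightedShift_periodic {c : ℤ → ℝ} (hc : ∃ C, ∀ n, |c n| ≤ C) (k q : ℤ)
    (hq : ∀ n, c (n + q) = c n) (h1 : ∃ C, ∀ _ : ℤ, |(1 : ℝ)| ≤ C) :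
    Commute (weightedShift (fun _ => 1) h1 q) (weightedShift c hc k) := by
  ext φ n
  change weightedShift (fun _ => 1) h1 q (weightedShift c hc k φ) n
    = weightedShift c hc k (weightedShift (fun _ => 1) h1 q φ) n
  simp only [weightedShift_apply, hq]
  rw [add_right_comm]
  push_cast
  ring

/-- The translation `(S_k φ)_n = φ_{n+k}`. -/
def shift (k : ℤ) : L2Z →L[ℂ] L2Z := weightedShift (fun _ => 1) ⟨1, fun _ => by simp⟩ k

@[simp]
theorem shift_apply (k : ℤ) (φ : L2Z) (n : ℤ) : shift k φ n = φ (n + k) := by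
  rw [shift, weightedShift_apply]; simp

theorem shift_delta (k m : ℤ) : shift k (delta m) = delta (m - k) := by
  rw [shift, weightedShift_delta]; simp

theorem norm_apply_coord_le (φ : L2Z) (n : ℤ) : ‖φ n‖ ≤ ‖φ‖ :=
  lp.norm_apply_le_norm (by norm_num) φ n

theorem norm_sum_delta_sq (f : ℕ → ℤ) (hf : Function.Injective f) (N : ℕ) :
    ‖∑ j ∈ Finset.range N, delta (f j)‖ ^ 2 = N := by
  have h := lp.norm_sum_single (p := 2) (E := fun _ : ℤ => ℂ) (by norm_num) (fun _ => 1)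
    ((Finset.range N).map ⟨f, hf⟩)
  rw [Finset.sum_map] at h
  simpa [delta] using h

/-- If `Z` is small on the range of `S_q - S_{-q}`, it is small on every `δ_n`. -/
theorem norm_apply_delta_le {Z : L2Z →L[ℂ] L2Z} {c e : ℝ} {q : ℤ} (hq : q ≠ 0) (hZ : ‖Z‖ ≤ c)
    (he : ‖Z * (shift q - shift (-q))‖ ≤ e) (n : ℤ) {N : ℕ} (hN : 0 < N) :
    ‖Z (delta n)‖ ≤ e * N + c / √N := by
  have he0 : 0 ≤ e := (norm_nonneg _).trans he
  have hstep : ∀ m : ℤ, ‖Z (delta m) - Z (delta (m + 2 * q))‖ ≤ e := fun m => by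
    have h : Z (delta m) - Z (delta (m + 2 * q))
        = (Z * (shift q - shift (-q))) (delta (m + q)) := by
      change _ = Z (shift q (delta (m + q)) - shift (-q) (delta (m + q)))
      rw [shift_delta, shift_delta, map_sub]
      rw [add_sub_cancel_right, sub_neg_eq_add, add_assoc, ← two_mul]
    rw [h]
    exact ((ContinuousLinearMap.le_opNorm _ (delta (m + q))).trans_eq
      (by rw [norm_delta, mul_one])).trans he
  have htel : ∀ j : ℕ, ‖Z (delta n) - Z (delta (n + 2 * q * j))‖ ≤ j * e := fun j => by
    induction j with
    | zero => simp
    | succ j ih =>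
      have h := norm_add_le (Z (delta n) - Z (delta (n + 2 * q * j)))
        (Z (delta (n + 2 * q * j)) - Z (delta (n + 2 * q * j + 2 * q)))
      rw [sub_add_sub_cancel] at h
      have e1 : n + 2 * q * ((j + 1 : ℕ) : ℤ) = n + 2 * q * j + 2 * q := by push_cast; ring
      rw [e1]
      push_cast
      linarith [hstep (n + 2 * q * j)]
  have hinj : Function.Injective fun j : ℕ => n + 2 * q * (j : ℤ) := fun i j h => by
    have h' : 2 * q * (i : ℤ) = 2 * q * j := by simpa using h
    exact_mod_cast mul_left_cancel₀ (mul_ne_zero two_ne_zero hq) h'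
  have hS := norm_sum_delta_sq _ hinj N
  set S := ∑ j ∈ Finset.range N, delta (n + 2 * q * (j : ℤ)) with hSdef
  have hS' : ‖S‖ = √N := by rw [← hS, Real.sqrt_sq (norm_nonneg _)]
  -- Average over `N` translates: each difference telescopes at cost at most `e * N`, while the
  -- orthonormal sum `S` has norm only `√N`, which produces `c / √N` after division by `N`.
  have hsum : (N : ℂ) • Z (delta n)
      = ∑ j ∈ Finset.range N, (Z (delta n) - Z (delta (n + 2 * q * (j : ℤ)))) + Z S := by
    rw [hSdef, map_sum, ← Finset.sum_add_distrib]
    simp [← Nat.cast_smul_eq_nsmul ℂ]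
  have hN0 : (0 : ℝ) < N := by exact_mod_cast hN
  have hle : N * ‖Z (delta n)‖ ≤ N * (e * N) + c * √N := by
    have h1 : ‖(N : ℂ) • Z (delta n)‖ = N * ‖Z (delta n)‖ := by
      rw [norm_smul, Complex.norm_natCast]
    rw [← h1, hsum]
    refine (norm_add_le _ _).trans (add_le_add ?_ ?_)
    · refine (norm_sum_le_of_le (n := fun _ => e * N) _ fun j hj => (htel j).trans ?_).trans_eq
        (by simp)
      rw [mul_comm]
      gcongr
      exact (Finset.mem_range.1 hj).le
    · rw [← hS']
      exact (Z.le_opNorm S).trans (by gcongr)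
  have h2 : c * √N = N * (c / √N) := by
    rw [← mul_div_assoc, mul_comm (N : ℝ), mul_div_assoc, Real.div_sqrt]
  rw [h2, ← mul_add] at hle
  exact le_of_mul_le_mul_left hle hN0

end Shifts

/-! ### The velocity operator, its polynomial commutators and periodic translations. -/

namespace JacobiMatrix

variable (J : JacobiMatrix)

theorem a_pos' (n : ℤ) : 0 < J.a n := by
  obtain ⟨c, hc, h⟩ := J.a_pos
  exact hc.trans_le (h n)

theorem isSelfAdjoint_op : IsSelfAdjoint J.op := by
  rw [IsSelfAdjoint, op, star_add, star_add, star_weightedShift, star_weightedShift,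
    star_weightedShift]
  ext φ n
  simp only [_root_.add_apply, lp.coeFn_add, Pi.add_apply, weightedShift_apply]
  simp only [sub_zero, neg_zero, neg_neg, sub_neg_eq_add, add_sub_cancel_right]
  ring

theorem op_delta (m : ℤ) : J.op (delta m)
    = (J.a m : ℂ) • delta (m + 1) + (J.b m : ℂ) • delta m
      + (J.a (m - 1) : ℂ) • delta (m - 1) := by
  simp only [op, _root_.add_apply, weightedShift_delta, sub_zero, sub_neg_eq_add,
    add_sub_cancel_right]

/-- The bounded velocity operator `i[J, X]`. -/
def velocity : L2Z →L[ℂ] L2Z :=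
  Complex.I • (weightedShift J.a J.a_bounded 1
    - weightedShift (fun n => J.a (n - 1)) (J.a_bounded.imp fun _ h n => h (n - 1)) (-1))

theorem velocity_apply (φ : L2Z) (n : ℤ) : J.velocity φ n
    = Complex.I * ((J.a n : ℂ) * φ (n + 1) - (J.a (n - 1) : ℂ) * φ (n - 1)) := rfl

theorem velocity_delta (m : ℤ) : J.velocity (delta m)
    = Complex.I • ((J.a (m - 1) : ℂ) • delta (m - 1) - (J.a m : ℂ) • delta (m + 1)) := by
  simp only [velocity, _root_.smul_apply, _root_.sub_apply,
    weightedShift_delta, sub_neg_eq_add, add_sub_cancel_right]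

theorem isSelfAdjoint_velocity : IsSelfAdjoint J.velocity := by
  rw [IsSelfAdjoint, velocity, star_smul, star_sub, star_weightedShift, star_weightedShift]
  simp only [sub_neg_eq_add, add_sub_cancel_right, neg_neg, Complex.star_def, Complex.conj_I,
    neg_smul, ← smul_neg, neg_sub]

theorem norm_coord_le {T : L2Z →L[ℂ] L2Z} {C : ℝ} (hT : ‖T‖ ≤ C) (m n : ℤ) :
    ‖T (delta m) n‖ ≤ C :=
  (norm_apply_coord_le _ n).trans (((T.le_opNorm _).trans_eq (by simp)).trans hT)

theorem op_delta_apply_left (n : ℤ) : J.op (delta (n + 1)) n = J.a n := by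
  have h : n - 1 ≠ n + 1 := by omega
  rw [op_apply]; simp [delta_apply, h]

theorem op_delta_apply_self (n : ℤ) : J.op (delta n) n = J.b n := by
  rw [op_apply]; simp [delta_apply]

variable {J}

theorem a_le_of_norm_le {R : ℝ} (h : ‖J.op‖ ≤ R) (n : ℤ) : J.a n ≤ R := by
  have h1 := norm_coord_le h (n + 1) n
  rw [op_delta_apply_left, Complex.norm_real] at h1
  exact (le_abs_self _).trans h1

theorem abs_b_le_of_norm_le {R : ℝ} (h : ‖J.op‖ ≤ R) (n : ℤ) : |J.b n| ≤ R := by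
  have h1 := norm_coord_le h n n
  rwa [op_delta_apply_self, Complex.norm_real] at h1

theorem abs_a_sub_le (J J' : JacobiMatrix) (n : ℤ) : |J.a n - J'.a n| ≤ ‖J.op - J'.op‖ := by
  have h1 := norm_coord_le (le_refl ‖J.op - J'.op‖) (n + 1) n
  rw [_root_.sub_apply, lp.coeFn_sub, Pi.sub_apply, op_delta_apply_left,
    op_delta_apply_left, ← Complex.ofReal_sub, Complex.norm_real] at h1
  exact h1

theorem norm_velocity_le {R : ℝ} (h : ‖J.op‖ ≤ R) : ‖J.velocity‖ ≤ 2 * R := by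
  have ha : ∀ n, |J.a n| ≤ R := fun n => by
    rw [abs_of_pos (J.a_pos' n)]; exact a_le_of_norm_le h n
  rw [velocity, norm_smul, Complex.norm_I, one_mul, two_mul]
  exact (norm_sub_le _ _).trans (add_le_add (norm_weightedShift_le _ _ ha)
    (norm_weightedShift_le _ _ fun n => ha (n - 1)))

theorem norm_velocity_sub_le (J J' : JacobiMatrix) :
    ‖J.velocity - J'.velocity‖ ≤ 2 * ‖J.op - J'.op‖ := by
  have ha := abs_a_sub_le J J'
  have hb : ∃ C, ∀ n, |J.a n - J'.a n| ≤ C := ⟨_, ha⟩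
  have e : J.velocity - J'.velocity = Complex.I • (weightedShift (fun n => J.a n - J'.a n) hb 1
      - weightedShift (fun n => J.a (n - 1) - J'.a (n - 1))
        (hb.imp fun _ h n => h (n - 1)) (-1)) := by
    ext φ n
    change J.velocity φ n - J'.velocity φ n = Complex.I * (((J.a n - J'.a n : ℝ) : ℂ) * φ (n + 1)
      - ((J.a (n - 1) - J'.a (n - 1) : ℝ) : ℂ) * φ (n - 1))
    rw [velocity_apply, velocity_apply]
    push_cast
    ring
  rw [e, norm_smul, Complex.norm_I, one_mul, two_mul]
  exact (norm_sub_le _ _).trans (add_le_add (norm_weightedShift_le _ _ ha)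
    (norm_weightedShift_le _ _ fun n => ha (n - 1)))

/-- Identifies the purely algebraic `powComm` with the commutator `i[J^m, X]` through matrix
elements, so that the unbounded `X` need not appear. -/
theorem powComm_delta_apply (J : JacobiMatrix) (m : ℕ) (l n : ℤ) :
    powComm J.op J.velocity m (delta l) n
      = Complex.I * ((l : ℂ) - n) * (J.op ^ m) (delta l) n := by
  induction m generalizing l with
  | zero =>
    rw [powComm, pow_zero]
    change (0 : L2Z) n = _ * delta l n
    rw [delta_apply]
    by_cases h : n = l <;> simp [h]
  | succ m ih =>
    have e1 : powComm J.op J.velocity (m + 1) (delta l)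
        = powComm J.op J.velocity m (J.op (delta l)) + (J.op ^ m) (J.velocity (delta l)) := rfl
    have e2 : (J.op ^ (m + 1)) (delta l) = (J.op ^ m) (J.op (delta l)) := by rw [pow_succ]; rfl
    rw [e1, e2, op_delta, velocity_delta]
    simp only [map_add, map_sub, map_smul, lp.coeFn_add, lp.coeFn_sub, lp.coeFn_smul, Pi.add_apply,
      Pi.sub_apply, Pi.smul_apply, smul_eq_mul, ih]
    push_cast
    ring

theorem polyComm_delta_apply (J : JacobiMatrix) (p : ℂ[X]) (l n : ℤ) :
    polyComm J.op J.velocity p (delta l) n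
      = Complex.I * ((l : ℂ) - n) * aeval J.op p (delta l) n := by
  rw [polyComm, aeval_eq_sum_range, Polynomial.sum_over_range _ (by simp)]
  simp only [_root_.sum_apply, lp.coeFn_sum, Finset.sum_apply, Finset.mul_sum,
    _root_.smul_apply, lp.coeFn_smul, Pi.smul_apply, smul_eq_mul,
    powComm_delta_apply]
  exact Finset.sum_congr rfl fun m _ => by ring

/-- `i[S_q + S_{-q}, X]`. -/
def shiftComm (q : ℤ) : L2Z →L[ℂ] L2Z := (Complex.I * q) • (shift q - shift (-q))

theorem polyComm_eq_shiftComm (J : JacobiMatrix) {p : ℂ[X]} {q : ℤ}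
    (hp : ∀ m, aeval J.op p (delta m) = delta (m + q) + delta (m - q)) :
    polyComm J.op J.velocity p = shiftComm q := by
  refine clm_ext_delta fun l => ?_
  ext n
  rw [polyComm_delta_apply, hp, shiftComm]
  simp only [_root_.smul_apply, _root_.sub_apply, shift_delta,
    lp.coeFn_add, lp.coeFn_sub, lp.coeFn_smul, Pi.add_apply, Pi.sub_apply, Pi.smul_apply,
    smul_eq_mul, delta_apply, sub_neg_eq_add]
  by_cases h1 : n = l + q <;> by_cases h2 : n = l - q
  · obtain rfl : q = 0 := by omega
    have h : (n : ℂ) = l := by exact_mod_cast h1.trans (add_zero l)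
    simp [h]
  · rw [if_pos h1, if_neg h2, h1]
    push_cast
    ring
  · rw [if_neg h1, if_pos h2, h2]
    push_cast
    ring
  · simp [h1, h2]

theorem commute_shift_op {q : ℕ} (hJ : J.IsPeriodic q) : Commute (shift q) J.op := by
  have ha : ∀ n : ℤ, J.a (n + q) = J.a n := fun n => (hJ.2 n).1
  have hb : ∀ n : ℤ, J.b (n + q) = J.b n := fun n => (hJ.2 n).2
  refine ((commute_weightedShift_periodic _ _ _ (fun n => ?_) _).add_right
    (commute_weightedShift_periodic _ _ _ hb _)).add_right
    (commute_weightedShift_periodic _ _ _ ha _)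
  rw [← ha (n - 1)]
  ring_nf

theorem commute_shift_velocity {q : ℕ} (hJ : J.IsPeriodic q) : Commute (shift q) J.velocity := by
  have ha : ∀ n : ℤ, J.a (n + q) = J.a n := fun n => (hJ.2 n).1
  refine ((commute_weightedShift_periodic _ _ _ ha _).sub_right
    (commute_weightedShift_periodic _ _ _ (fun n => ?_) _)).smul_right _
  rw [← ha (n - 1)]
  ring_nf

theorem star_shift (k : ℤ) : star (shift k) = shift (-k) := star_weightedShift _ _

/-- Self-adjointness of `B` transfers commutation from `S_q` to its adjoint `S_{-q}`. -/
theorem commute_shiftComm {q : ℤ} {B : L2Z →L[ℂ] L2Z} (hB : IsSelfAdjoint B)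
    (h : Commute (shift q) B) : Commute (shiftComm q) B := by
  have h' : Commute (shift (-q)) B := by
    have := h.star_star
    rwa [star_shift, hB.star_eq] at this
  exact (h.sub_left h').smul_left _

end JacobiMatrix

end JacobiDynamics

namespace JacobiDynamics

/-! ### Transfer matrices, the discriminant, and quantitative estimates for periodic `J`. -/

namespace JacobiMatrix

open Polynomial

variable (J : JacobiMatrix)

/-- The one-step transfer matrix, with polynomial entries in the spectral parameter. -/
def transferStep (n : ℤ) : Matrix (Fin 2) (Fin 2) ℂ[X] :=
  !![C ((J.a n : ℂ)⁻¹) * (X + C (-(J.b n : ℂ))), C (-(J.a (n - 1) / J.a n : ℂ)); 1, 0]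

/-- The transfer matrix from `(δ_{n+1}, δ_n)` to `(δ_{n+j+1}, δ_{n+j})`. -/
def transfer (n : ℤ) : ℕ → Matrix (Fin 2) (Fin 2) ℂ[X]
  | 0 => 1
  | j + 1 => J.transferStep (n + j + 1) * transfer n j

theorem transfer_succ (n : ℤ) (j : ℕ) :
    J.transfer n (j + 1) = J.transferStep (n + j + 1) * J.transfer n j := rfl

theorem transfer_succ' (n : ℤ) (j : ℕ) :
    J.transfer n (j + 1) = J.transfer (n + 1) j * J.transferStep (n + 1) := by
  induction j with
  | zero => simp [transfer]
  | succ j ih =>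
    rw [transfer_succ, ih, transfer_succ, mul_assoc]
    congr 2
    push_cast
    ring

theorem a_ne_zero (n : ℤ) : (J.a n : ℂ) ≠ 0 := by exact_mod_cast (J.a_pos' n).ne'

theorem det_transferStep (n : ℤ) :
    (J.transferStep n).det = C (J.a (n - 1) / J.a n : ℂ) := by
  rw [transferStep, Matrix.det_fin_two_of]
  simp

theorem det_transfer (n : ℤ) (j : ℕ) :
    (J.transfer n j).det = C (J.a n / J.a (n + j) : ℂ) := by
  induction j with
  | zero => simp [transfer, div_self (J.a_ne_zero n)]
  | succ j ih =>
    rw [transfer_succ, Matrix.det_mul, ih, det_transferStep, ← C_mul]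
    congr 1
    have h1 := J.a_ne_zero (n + j)
    have h2 := J.a_ne_zero (n + (j + 1 : ℕ))
    have e : n + j + 1 = n + ((j + 1 : ℕ) : ℤ) := by push_cast; ring
    rw [add_sub_cancel_right, e]
    field_simp

/-- Solving the formula for `J δ_m` for `δ_{m+1}` gives the three-term recurrence with the spectral
parameter replaced by `J` itself, so the transfer matrices act on actual `ℓ²` vectors. -/
theorem transfer_delta (n : ℤ) (j : ℕ) :
    delta (n + j + 1) = aeval J.op (J.transfer n j 0 0) (delta (n + 1))
        + aeval J.op (J.transfer n j 0 1) (delta n) ∧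
      delta (n + j) = aeval J.op (J.transfer n j 1 0) (delta (n + 1))
        + aeval J.op (J.transfer n j 1 1) (delta n) := by
  induction j with
  | zero => simp [transfer]
  | succ j ih =>
    obtain ⟨ih0, ih1⟩ := ih
    have e : n + ((j + 1 : ℕ) : ℤ) = n + j + 1 := by push_cast; ring
    have h0 : ∀ i, J.transfer n (j + 1) 0 i
        = C ((J.a (n + j + 1) : ℂ)⁻¹) * (X + C (-(J.b (n + j + 1) : ℂ))) * J.transfer n j 0 i
          + C (-(J.a (n + j) / J.a (n + j + 1) : ℂ)) * J.transfer n j 1 i := fun i => by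
      rw [transfer_succ, Matrix.mul_apply, Fin.sum_univ_two]
      simp [transferStep]
    have h1 : ∀ i, J.transfer n (j + 1) 1 i = J.transfer n j 0 i := fun i => by
      rw [transfer_succ, Matrix.mul_apply, Fin.sum_univ_two]
      simp [transferStep]
    have hstep : delta (n + j + 1 + 1) = aeval J.op (C ((J.a (n + j + 1) : ℂ)⁻¹)
          * (X + C (-(J.b (n + j + 1) : ℂ)))) (delta (n + j + 1))
        + aeval J.op (C (-(J.a (n + j) / J.a (n + j + 1) : ℂ))) (delta (n + j)) := by
      have hd := J.op_delta (n + j + 1)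
      have hne := J.a_ne_zero (n + j + 1)
      simp only [map_mul, map_add, aeval_C, aeval_X, Algebra.algebraMap_eq_smul_one, smul_mul_assoc,
        one_mul, _root_.smul_apply, _root_.add_apply, one_apply_eq_self, hd,
        add_sub_cancel_right, smul_add, smul_smul, inv_mul_cancel₀ hne, one_smul]
      rw [← sub_eq_zero]
      match_scalars <;> field_simp <;> ring
    rw [e]
    refine ⟨?_, ?_⟩
    · rw [hstep, h0, h0]
      conv_lhs => rw [ih0, ih1]
      simp only [map_mul, map_add, mul_apply_eq_comp, _root_.add_apply]
      abel
    · rw [h1, h1, ih0]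

/-- The discriminant of a `q`-periodic Jacobi matrix. -/
def discriminant (q : ℕ) : ℂ[X] := (J.transfer 0 q).trace

variable {J}

theorem transferStep_add_period {q : ℕ} (hJ : J.IsPeriodic q) (n : ℤ) :
    J.transferStep (n + q) = J.transferStep n := by
  have h1 := (hJ.2 n).1
  have h2 := (hJ.2 n).2
  have h3 := (hJ.2 (n - 1)).1
  rw [transferStep, transferStep, h1, h2, add_sub_right_comm, h3]

theorem transfer_add_period {q : ℕ} (hJ : J.IsPeriodic q) (n : ℤ) (j : ℕ) :
    J.transfer (n + q) j = J.transfer n j := by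
  induction j with
  | zero => rfl
  | succ j ih =>
    rw [transfer_succ, transfer_succ, ih, ← transferStep_add_period hJ (n + j + 1)]
    congr 2
    ring

/-- Moving the base point by one site permutes the factors of the monodromy matrix cyclically. -/
theorem trace_transfer {q : ℕ} (hJ : J.IsPeriodic q) (n : ℤ) :
    (J.transfer n q).trace = J.discriminant q := by
  have hs : ∀ n, (J.transfer (n + 1) q).trace = (J.transfer n q).trace := fun n => by
    obtain ⟨j, rfl⟩ := Nat.exists_eq_succ_of_ne_zero hJ.1.ne'
    rw [Nat.succ_eq_add_one] at *
    rw [transfer_succ' J n, transfer_succ, Matrix.trace_mul_comm,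
      ← transferStep_add_period hJ (n + 1)]
    congr 3
    push_cast
    ring
  induction n using Int.induction_on with
  | zero => rfl
  | succ n ih => rw [hs, ih]
  | pred n ih => rw [← ih, ← hs (-n - 1), sub_add_cancel]

/-- `Δ(J) = S_q + S_{-q}`, on the standard basis. -/
theorem aeval_discriminant_delta {q : ℕ} (hJ : J.IsPeriodic q) (m : ℤ) :
    aeval J.op (J.discriminant q) (delta m) = delta (m + q) + delta (m - q) := by
  obtain ⟨n, rfl⟩ : ∃ n : ℤ, m = n + q := ⟨m - q, by ring⟩
  rw [← trace_transfer hJ n, Matrix.trace_fin_two, add_sub_cancel_right]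
  obtain ⟨h0, h1⟩ := J.transfer_delta n q
  obtain ⟨-, h2⟩ := J.transfer_delta (n + q) q
  rw [transfer_add_period hJ] at h2
  -- Over a full period the determinant is `1`, so Cayley–Hamilton reads `M² + 1 = (tr M) M`; its
  -- second row, applied to `(δ_{n+1}, δ_n)`, is the claim. The rest verifies this row by hand.
  have hdet := J.det_transfer n q
  rw [(hJ.2 n).1, div_self (J.a_ne_zero n), C_1, Matrix.det_fin_two] at hdet
  have hdet' := congrArg (fun p => aeval J.op p (delta n)) hdet
  rw [h2, h0]
  set M := J.transfer n q
  simp only [map_sub, map_mul, map_one, map_add, mul_apply_eq_comp,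
    _root_.sub_apply, _root_.add_apply, one_apply_eq_self] at hdet' ⊢
  have c1 : aeval J.op (M 0 0) (aeval J.op (M 1 0) (delta (n + 1)))
      = aeval J.op (M 1 0) (aeval J.op (M 0 0) (delta (n + 1))) := by
    simp only [← mul_apply_eq_comp, ← map_mul, mul_comm]
  have c2 : aeval J.op (M 0 1) (aeval J.op (M 1 0) (delta n))
      = aeval J.op (M 1 0) (aeval J.op (M 0 1) (delta n)) := by
    simp only [← mul_apply_eq_comp, ← map_mul, mul_comm]
  conv_lhs => rw [h1]
  conv_rhs => rw [h1]
  rw [c2] at hdet'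
  simp only [map_add, c1]
  rw [eq_add_of_sub_eq hdet']
  abel

/-- One step costs `L(4L + L)` from `a⁻¹(X - b)` at radius `4L`, plus `L · L` from the ratio of the
`a`'s: `6L²` in all. -/
theorem polyNorm_transfer_le {L : ℝ} (hL : 1 ≤ L) (hJ : ‖J.op‖ ≤ L) (ha : ∀ n, L⁻¹ ≤ J.a n)
    (n : ℤ) (j : ℕ) (i k : Fin 2) :
    polyNorm (4 * L) (J.transfer n j i k) ≤ (6 * L ^ 2) ^ j := by
  have hL0 : 0 < L := by linarith
  have hr : 0 ≤ 4 * L := by linarith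
  have hainv : ∀ n, ‖((J.a n : ℂ)⁻¹)‖ ≤ L := fun n => by
    rw [norm_inv, Complex.norm_real, Real.norm_eq_abs, abs_of_pos (J.a_pos' n)]
    exact inv_le_of_inv_le₀ hL0 (ha n)
  induction j generalizing i with
  | zero =>
    rw [transfer, pow_zero]
    by_cases h : i = k
    · rw [h, Matrix.one_apply_eq, polyNorm_one]
    · rw [Matrix.one_apply_ne h, polyNorm_zero]; exact zero_le_one
  | succ j ih =>
    have hB : 0 ≤ (6 * L ^ 2) ^ j := by positivity
    have h6 : 1 ≤ 6 * L ^ 2 := by nlinarith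
    rw [transfer_succ, Matrix.mul_apply, Fin.sum_univ_two, pow_succ]
    have i0 := ih 0
    have i1 := ih 1
    set B := (6 * L ^ 2) ^ j
    match i with
    | 0 =>
      have e : J.transferStep (n + j + 1) 0 0 * J.transfer n j 0 k
            + J.transferStep (n + j + 1) 0 1 * J.transfer n j 1 k
          = C ((J.a (n + j + 1) : ℂ)⁻¹) * (X * J.transfer n j 0 k
              + C (-(J.b (n + j + 1) : ℂ)) * J.transfer n j 0 k)
            + C (-(J.a (n + j) / J.a (n + j + 1) : ℂ)) * J.transfer n j 1 k := by
        simp [transferStep]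
        ring
      rw [e]
      refine (polyNorm_add_le hr _ _).trans ?_
      have hb : ‖(-(J.b (n + j + 1) : ℂ))‖ ≤ L := by
        rw [norm_neg, Complex.norm_real]
        exact abs_b_le_of_norm_le hJ _
      have hc : ‖(-(J.a (n + j) / J.a (n + j + 1) : ℂ))‖ ≤ L * L := by
        rw [norm_neg, div_eq_mul_inv, norm_mul, Complex.norm_real, Real.norm_eq_abs,
          abs_of_pos (J.a_pos' _)]
        exact mul_le_mul (a_le_of_norm_le hJ _) (hainv _) (norm_nonneg _) hL0.le
      have h1 : polyNorm (4 * L) (X * J.transfer n j 0 k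
          + C (-(J.b (n + j + 1) : ℂ)) * J.transfer n j 0 k) ≤ 5 * L * B := by
        refine (polyNorm_add_le hr _ _).trans ?_
        rw [polyNorm_X_mul, polyNorm_C_mul]
        have h2 : 4 * L * polyNorm (4 * L) (J.transfer n j 0 k) ≤ 4 * L * B := by gcongr
        have h3 := mul_le_mul hb i0 (polyNorm_nonneg hr _) hL0.le
        linarith
      rw [polyNorm_C_mul, polyNorm_C_mul]
      have h2 := mul_le_mul (hainv (n + j + 1)) h1 (polyNorm_nonneg hr _) hL0.le
      have h3 := mul_le_mul hc i1 (polyNorm_nonneg hr _) (by positivity)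
      nlinarith
    | 1 =>
      have e : J.transferStep (n + j + 1) 1 0 * J.transfer n j 0 k
            + J.transferStep (n + j + 1) 1 1 * J.transfer n j 1 k = J.transfer n j 0 k := by
        simp [transferStep]
      rw [e]
      exact i0.trans (le_mul_of_one_le_right hB h6)

theorem polyNorm_discriminant_le {L : ℝ} (hL : 1 ≤ L) (hJ : ‖J.op‖ ≤ L)
    (ha : ∀ n, L⁻¹ ≤ J.a n) (q : ℕ) :
    polyNorm (4 * L) (J.discriminant q) ≤ 2 * (6 * L ^ 2) ^ q := by
  rw [discriminant, Matrix.trace_fin_two, two_mul]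
  exact (polyNorm_add_le (by linarith) _ _).trans
    (add_le_add (polyNorm_transfer_le hL hJ ha _ _ _ _) (polyNorm_transfer_le hL hJ ha _ _ _ _))

/-- For periodic `J`, the time averages of the velocity on `δ_n` are Cauchy with a rate. -/
theorem norm_timeAverage_velocity_sub_delta_le {L : ℝ} (hL : 1 ≤ L) (hJ : ‖J.op‖ ≤ L)
    (ha : ∀ n, L⁻¹ ≤ J.a n) {q : ℕ} (hq : J.IsPeriodic q) {τ s t : ℝ} (hτ : 1 ≤ τ)
    (hs : τ ^ 3 ≤ s) (ht : τ ^ 3 ≤ t) (n : ℤ) :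
    ‖(timeAverage J.op J.velocity t - timeAverage J.op J.velocity s) (delta n)‖
      ≤ (792 * L ^ 4) ^ q / τ := by
  have hτ0 : 0 < τ := by linarith
  have hτ3 : 0 < τ ^ 3 := by positivity
  have hq1 : (1 : ℝ) ≤ q := by exact_mod_cast hq.1
  have hsa := J.isSelfAdjoint_op
  have hv := norm_velocity_le hJ
  have hKH := commute_shiftComm hsa (commute_shift_op hq)
  have hKA := commute_shiftComm J.isSelfAdjoint_velocity (commute_shift_velocity hq)
  have h := norm_timeAverage_sub_mul_le hsa hL hJ hτ3 hs ht
    (polyComm_eq_shiftComm J (aeval_discriminant_delta hq)) hKH hKA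
  have hB := polyNorm_discriminant_le hL hJ ha q
  have hB0 := polyNorm_nonneg (by linarith : 0 ≤ 4 * L) (J.discriminant q)
  set Z := timeAverage J.op J.velocity t - timeAverage J.op J.velocity s with hZdef
  have hZ : ‖Z‖ ≤ 4 * L := by
    have h1 := norm_timeAverage_le hsa J.velocity (hτ3.trans_le ht)
    have h2 := norm_timeAverage_le hsa J.velocity (hτ3.trans_le hs)
    exact (norm_sub_le _ _).trans (by linarith)
  set D := (6 * L ^ 2) ^ q
  have hD : 1 ≤ D := one_le_pow₀ (by nlinarith)
  have hZK : ‖Z * (shift q - shift (-q))‖ ≤ 64 * L ^ 2 * D / τ ^ 3 := by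
    have e : ‖Z * shiftComm q‖ = q * ‖Z * (shift q - shift (-q))‖ := by
      rw [shiftComm, mul_smul_comm, norm_smul, norm_mul, Complex.norm_I, one_mul]
      simp
    rw [e] at h
    have h1 : ‖Z * (shift q - shift (-q))‖ ≤ q * ‖Z * (shift q - shift (-q))‖ :=
      le_mul_of_one_le_left (norm_nonneg _) hq1
    refine (h1.trans h).trans ?_
    calc 8 * ‖J.velocity‖ ^ 2 / τ ^ 3 * polyNorm (4 * L) (J.discriminant q)
        ≤ 8 * (2 * L) ^ 2 / τ ^ 3 * (2 * D) := by gcongr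
      _ = 64 * L ^ 2 * D / τ ^ 3 := by ring
  -- With `e` of order `τ⁻³`, taking `N ≈ τ²` balances `e * N` against `c / √N`; this is why times
  -- are measured from `τ ^ 3`.
  have hN : 0 < ⌈τ ^ 2⌉₊ := Nat.ceil_pos.2 (by positivity)
  have hfin := norm_apply_delta_le (q := (q : ℤ)) (by exact_mod_cast hq.1.ne') hZ hZK n hN
  have hN1 : (⌈τ ^ 2⌉₊ : ℝ) ≤ 2 * τ ^ 2 := by
    have := (Nat.ceil_lt_add_one (by positivity : 0 ≤ τ ^ 2)).le
    nlinarith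
  have hN2 : τ ≤ √(⌈τ ^ 2⌉₊ : ℝ) := Real.le_sqrt_of_sq_le (Nat.le_ceil _)
  -- `132 = 2 · 64 + 4` collects the two contributions, and `792 = 132 · 6`; the prefactor enters
  -- the `q`-th power because `q ≥ 1`.
  have h792 : 132 * L ^ 2 * D ≤ (792 * L ^ 4) ^ q := by
    have e : (792 * L ^ 4 : ℝ) = (132 * L ^ 2) * (6 * L ^ 2) := by ring
    rw [e, mul_pow]
    gcongr
    exact le_self_pow₀ (by nlinarith) hq.1.ne'
  calc ‖Z (delta n)‖ ≤ 64 * L ^ 2 * D / τ ^ 3 * ⌈τ ^ 2⌉₊ + 4 * L / √(⌈τ ^ 2⌉₊ : ℝ) := hfin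
    _ ≤ 64 * L ^ 2 * D / τ ^ 3 * (2 * τ ^ 2) + 4 * L / τ := by gcongr
    _ = (128 * L ^ 2 * D + 4 * L) / τ := by field_simp; ring
    _ ≤ (132 * L ^ 2 * D) / τ := by
      gcongr
      have h1 : L ≤ L ^ 2 := by nlinarith
      have h2 : L ^ 2 ≤ L ^ 2 * D := le_mul_of_one_le_right (by positivity) hD
      linarith
    _ ≤ _ := by gcongr

/-- For periodic `J`, a quantitative lower bound for the time averages of the velocity. -/
theorem norm_shift_sub_shift_le {L : ℝ} (hL : 1 ≤ L) (hJ : ‖J.op‖ ≤ L)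
    (ha : ∀ n, L⁻¹ ≤ J.a n) {q : ℕ} (hq : J.IsPeriodic q) {t : ℝ} (ht : 0 < t) (φ : L2Z) :
    ‖shift q φ - shift (-q) φ‖
      ≤ (792 * L ^ 4) ^ q * (‖timeAverage J.op J.velocity t φ‖ + ‖φ‖ / t) := by
  have hL0 : 0 < L := by linarith
  have hq1 : (1 : ℝ) ≤ q := by exact_mod_cast hq.1
  have hsa := J.isSelfAdjoint_op
  have hv := norm_velocity_le hJ
  have hKH := commute_shiftComm hsa (commute_shift_op hq)
  have h := norm_apply_le_timeAverage hsa hL hJ ht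
    (polyComm_eq_shiftComm J (aeval_discriminant_delta hq)) hKH φ
  have hB := polyNorm_discriminant_le hL hJ ha q
  have e : ‖shiftComm q φ‖ = q * ‖shift q φ - shift (-q) φ‖ := by
    rw [shiftComm, _root_.smul_apply, norm_smul, norm_mul, Complex.norm_I, one_mul]
    simp
  rw [e] at h
  have h1 : ‖shift q φ - shift (-q) φ‖ ≤ q * ‖shift q φ - shift (-q) φ‖ :=
    le_mul_of_one_le_left (norm_nonneg _) hq1
  refine (h1.trans h).trans ?_
  have h16 : 16 * L * (6 * L ^ 2) ^ q ≤ (792 * L ^ 4) ^ q := by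
    have h2 : 16 * L ≤ (132 * L ^ 2) ^ q := by
      refine le_trans ?_ (le_self_pow₀ (by nlinarith) hq.1.ne')
      nlinarith
    have e : (792 * L ^ 4) ^ q = (132 * L ^ 2) ^ q * (6 * L ^ 2) ^ q := by
      rw [← mul_pow]
      ring_nf
    rw [e]
    exact mul_le_mul_of_nonneg_right h2 (by positivity)
  set M := ‖timeAverage J.op J.velocity t φ‖
  calc polyNorm (4 * L) (J.discriminant q) * (M + 4 * ‖J.velocity‖ / t * ‖φ‖)
      ≤ 2 * (6 * L ^ 2) ^ q * (M + 4 * (2 * L) / t * ‖φ‖) := by gcongr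
    _ ≤ 2 * (6 * L ^ 2) ^ q * (8 * L * M + 4 * (2 * L) / t * ‖φ‖) := by
      gcongr
      exact le_mul_of_one_le_left (norm_nonneg _) (by linarith)
    _ = 16 * L * (6 * L ^ 2) ^ q * (M + ‖φ‖ / t) := by ring
    _ ≤ _ := by gcongr

end JacobiMatrix

end JacobiDynamics

/-! ### Strong limits from basis vectors, and `ℓ¹` vectors. -/

namespace JacobiDynamics

theorem hasSum_delta (φ : L2Z) : HasSum (fun n : ℤ => φ n • delta n) φ := by
  have h := lp.hasSum_single (p := 2) ENNReal.ofNat_ne_top φ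
  refine h.congr_fun fun n => ?_
  rw [delta, ← lp.single_smul, smul_eq_mul, mul_one]

theorem norm_apply_le_of_delta {Z : L2Z →L[ℂ] L2Z} {e : ℝ} (hZ : ∀ n, ‖Z (delta n)‖ ≤ e)
    {φ : L2Z} (hφ : Summable fun n => ‖φ n‖) : ‖Z φ‖ ≤ e * ∑' n, ‖φ n‖ := by
  have h := (hasSum_delta φ).mapL Z
  refine h.norm_le_of_bounded (hφ.hasSum.mul_left e) fun n => ?_
  rw [map_smul, norm_smul, mul_comm]
  exact mul_le_mul_of_nonneg_right (hZ n) (norm_nonneg _)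

/-- A uniformly bounded family of operators converges strongly as soon as it is Cauchy on the
standard basis. -/
theorem exists_tendsto_of_cauchy_delta {M : ℝ → L2Z →L[ℂ] L2Z} {c : ℝ}
    (hM : ∀ᶠ t in atTop, ‖M t‖ ≤ c)
    (hδ : ∀ n, CauchySeq fun t => M t (delta n)) :
    ∃ Q : L2Z →L[ℂ] L2Z, ∀ φ, Tendsto (fun t => M t φ) atTop (𝓝 (Q φ)) := by
  choose y hy using fun n => cauchySeq_tendsto_of_complete (hδ n)
  have hlim : ∀ φ : L2Z, ∃ z, Tendsto (fun t => M t φ) atTop (𝓝 z) := fun φ => by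
    refine cauchySeq_tendsto_of_complete (Metric.cauchySeq_iff'.2 fun ε hε => ?_)
    obtain ⟨t₀, ht₀⟩ := eventually_atTop.1 hM
    have hc : 0 ≤ c := (norm_nonneg _).trans (ht₀ t₀ le_rfl)
    have hε' : 0 < ε / (4 * (c + 1)) := by positivity
    obtain ⟨F, hF⟩ := (Metric.tendsto_nhds.1 (hasSum_delta φ) _ hε').exists
    set ψ := ∑ n ∈ F, φ n • delta n with hψ
    have hψM : CauchySeq fun t => M t ψ := by
      have h : Tendsto (fun t => ∑ n ∈ F, φ n • M t (delta n)) atTop (𝓝 (∑ n ∈ F, φ n • y n)) :=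
        tendsto_finsetSum _ fun n _ => (hy n).const_smul _
      simp only [hψ, map_sum, map_smul]
      exact h.cauchySeq
    obtain ⟨t₁, ht₁⟩ := Metric.cauchySeq_iff'.1 hψM (ε / 4) (by positivity)
    obtain ⟨t₂, ht₂⟩ := Metric.cauchySeq_iff.1 hψM (ε / 4) (by positivity)
    refine ⟨max t₀ t₂, fun t ht => ?_⟩
    have hsmall : ∀ t, t₀ ≤ t → ‖M t (φ - ψ)‖ ≤ ε / 4 := fun t ht => by
      have h1 : ‖φ - ψ‖ ≤ ε / (4 * (c + 1)) := by
        rw [← dist_eq_norm, dist_comm]; exact hF.le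
      calc ‖M t (φ - ψ)‖ ≤ ‖M t‖ * ‖φ - ψ‖ := (M t).le_opNorm _
        _ ≤ c * (ε / (4 * (c + 1))) := mul_le_mul (ht₀ t ht) h1 (norm_nonneg _) hc
        _ ≤ (c + 1) * (ε / (4 * (c + 1))) := by gcongr; linarith
        _ = ε / 4 := by field_simp
    have h1 := hsmall t ((le_max_left _ _).trans ht)
    have h2 := hsmall (max t₀ t₂) (le_max_left _ _)
    have h3 := ht₂ t ((le_max_right _ _).trans ht) (max t₀ t₂) (le_max_right _ _)
    rw [dist_eq_norm] at h3 ⊢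
    have e : M t φ - M (max t₀ t₂) φ
        = M t (φ - ψ) + (M t ψ - M (max t₀ t₂) ψ) - M (max t₀ t₂) (φ - ψ) := by
      rw [map_sub, map_sub]; abel
    rw [e]
    have h4 := norm_sub_le (M t (φ - ψ) + (M t ψ - M (max t₀ t₂) ψ)) (M (max t₀ t₂) (φ - ψ))
    have h5 := norm_add_le (M t (φ - ψ)) (M t ψ - M (max t₀ t₂) ψ)
    linarith
  choose Q hQ using hlim
  exact ⟨continuousLinearMapOfTendsto M (f := Q) (tendsto_pi_nhds.2 hQ), hQ⟩

theorem isSelfAdjoint_of_tendsto {M : ℝ → L2Z →L[ℂ] L2Z} {Q : L2Z →L[ℂ] L2Z}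
    (hM : ∀ t, IsSelfAdjoint (M t)) (hQ : ∀ φ, Tendsto (fun t => M t φ) atTop (𝓝 (Q φ))) :
    IsSelfAdjoint Q := by
  rw [ContinuousLinearMap.isSelfAdjoint_iff_isSymmetric]
  intro φ ψ
  have h1 := (hQ φ).inner (𝕜 := ℂ) (tendsto_const_nhds (x := ψ))
  have h2 := (tendsto_const_nhds (x := φ)).inner (𝕜 := ℂ) (hQ ψ)
  refine tendsto_nhds_unique h1 (h2.congr fun t => ?_)
  exact ((ContinuousLinearMap.isSelfAdjoint_iff_isSymmetric.1 (hM t)) φ ψ).symm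

/-- At the coordinate `n + q_k` the difference equals `φ_{n+2q_k} - φ_n`, and the first term tends
to zero because `n + 2q_k` escapes to infinity. -/
theorem eq_zero_of_tendsto_shift_sub {q : ℕ → ℕ} (hq : StrictMono q) {φ : L2Z}
    (hφ : Summable fun n => ‖φ n‖)
    (h : Tendsto (fun k => ‖shift (q k) φ - shift (-(q k : ℤ)) φ‖) atTop (𝓝 0)) : φ = 0 := by
  ext n
  have hinj : Function.Injective fun k => n + 2 * (q k : ℤ) := fun i j hij => by
    have : (q i : ℤ) = q j := by simpa using hij
    exact hq.injective (by exact_mod_cast this)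
  have h0 : Tendsto (fun k => ‖φ (n + 2 * (q k : ℤ))‖) atTop (𝓝 0) :=
    hφ.tendsto_cofinite_zero.comp (Nat.cofinite_eq_atTop ▸ hinj.tendsto_cofinite)
  have h1 : ∀ k, ‖φ n‖ ≤ ‖shift (q k) φ - shift (-(q k : ℤ)) φ‖ + ‖φ (n + 2 * (q k : ℤ))‖ :=
    fun k => by
      have hc := norm_apply_coord_le (shift (q k) φ - shift (-(q k : ℤ)) φ) (n + q k)
      rw [lp.coeFn_sub, Pi.sub_apply, shift_apply, shift_apply, add_neg_cancel_right,
        add_assoc, ← two_mul] at hc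
      have := norm_sub_norm_le (φ n) (φ (n + 2 * (q k : ℤ)))
      rw [norm_sub_rev] at this
      linarith
  have h2 := ge_of_tendsto' (h.add h0) h1
  rw [add_zero] at h2
  exact norm_le_zero_iff.1 h2

/-! ### The exponential class: passing from periodic to limit-periodic. -/

namespace JacobiMatrix

/-- Periodic approximants `J_k` of `J` with uniform bounds and an exponential rate. -/
structure Approximants (J : JacobiMatrix) (L η : ℝ) (Js : ℕ → JacobiMatrix) (q : ℕ → ℕ) :
    Prop where
  periodic : ∀ k, (Js k).IsPeriodic (q k)
  strictMono : StrictMono q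
  norm_le : ∀ k, ‖(Js k).op‖ ≤ L
  le_a : ∀ k n, L⁻¹ ≤ (Js k).a n
  dist_le : ∀ k, ‖J.op - (Js k).op‖ ≤ Real.exp (-(η * q (k + 1)))

theorem IsExpClass.exists_approximants {J : JacobiMatrix} {R η : ℝ} (hη : 0 ≤ η)
    (hJ : J.IsExpClass η) (hR : J.InClass R) :
    ∃ Js q, Approximants J (2 * max R 1) η Js q := by
  obtain ⟨-, Js, q, hper, hdvd, hlim⟩ := hJ
  have hq : StrictMono q := strictMono_nat_of_lt_succ fun k =>
    lt_of_le_of_ne (Nat.le_of_dvd (hper _).1 (hdvd k).1) (hdvd k).2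
  have hmax : 1 ≤ max R 1 := le_max_right _ _
  -- With `L = 2 max(R, 1)`, discard finitely many approximants so that the distance is below both
  -- `1` and `L⁻¹`. Then the norms are at most `R + 1 ≤ L`, and the `a`'s are at least `R⁻¹ - L⁻¹ ≥
  -- L⁻¹`.
  have hδ : 0 < (2 * max R 1)⁻¹ := by positivity
  obtain ⟨k₀, hk₀⟩ := eventually_atTop.1
    ((hlim.eventually (gt_mem_nhds zero_lt_one)).and (hlim.eventually (gt_mem_nhds hδ)))
  have hexp : ∀ k, 1 ≤ Real.exp (η * q (k + 1)) := fun k => Real.one_le_exp (by positivity)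
  have hle : ∀ k, ‖J.op - (Js k).op‖ ≤ Real.exp (η * q (k + 1)) * ‖J.op - (Js k).op‖ := fun k =>
    le_mul_of_one_le_left (norm_nonneg _) (hexp k)
  have hRpos : 0 < R := by
    have := (J.a_pos' 0).trans_le (a_le_of_norm_le hR.1 0)
    exact this
  have hinv : 2 * (2 * max R 1)⁻¹ ≤ R⁻¹ := by
    rw [mul_inv, ← mul_assoc, mul_inv_cancel₀ two_ne_zero, one_mul]
    exact inv_anti₀ hRpos (le_max_left _ _)
  refine ⟨fun k => Js (k + k₀), fun k => q (k + k₀), fun k => hper _,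
    fun i j hij => hq (by omega), fun k => ?_, fun k n => ?_, fun k => ?_⟩
  · have h1 := ((hle (k + k₀)).trans_lt (hk₀ (k + k₀) (by omega)).1).le
    have h2 := norm_sub_norm_le (Js (k + k₀)).op J.op
    rw [norm_sub_rev] at h2
    have := hR.1
    have := le_max_left R 1
    linarith
  · have h1 := ((hle (k + k₀)).trans_lt (hk₀ (k + k₀) (by omega)).2).le
    have h2 := (le_abs_self _).trans ((abs_a_sub_le J (Js (k + k₀)) n).trans h1)
    have h3 := hR.2 n
    linarith
  · have h1 := (hk₀ (k + k₀) (by omega)).1.le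
    rw [Real.exp_neg, ← one_div, le_div_iff₀ (Real.exp_pos _), mul_comm]
    convert h1 using 5
    congr 1
    omega

/-- The Cesàro mean `t⁻¹ ∫₀ᵗ e^{isJ} i[J, X] e^{-isJ} ds`. -/
def meanVelocity (J : JacobiMatrix) (t : ℝ) : L2Z →L[ℂ] L2Z := timeAverage J.op J.velocity t

namespace Approximants

variable {J : JacobiMatrix} {L η : ℝ} {Js : ℕ → JacobiMatrix} {q : ℕ → ℕ}

/-- The rate constant of the periodic estimates. -/
def rate (L : ℝ) : ℝ := Real.log (792 * L ^ 4)

theorem rate_nonneg (hL : 1 ≤ L) : 0 ≤ rate L :=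
  Real.log_nonneg (by have := one_le_pow₀ hL (n := 4); linarith)

theorem exp_rate_mul (hL : 1 ≤ L) (n : ℕ) : (792 * L ^ 4) ^ n = Real.exp (rate L * n) := by
  rw [mul_comm (rate L), Real.exp_nat_mul, rate, Real.exp_log (by positivity)]

/-- Up to time `exp(η q_{k+1} / 2)`, half of the exponential rate pays for the factor `t` in the
Duhamel bound. The other half, `6 rate + 3` per unit of `q_{k+1}`, more than covers the stated
decay. -/
theorem norm_meanVelocity_sub_le (hL : 1 ≤ L) (hη : η = 6 * (2 * rate L + 1))
    (h : Approximants J L η Js q) (k : ℕ) {t : ℝ} (ht1 : 1 ≤ t)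
    (ht : t ≤ Real.exp (η * q (k + 1) / 2)) :
    ‖J.meanVelocity t - (Js k).meanVelocity t‖ ≤ 6 * L * Real.exp (-((rate L + 1) * q k)) := by
  have hr := rate_nonneg hL
  have h1 := norm_timeAverage_sub_le (Js k).isSelfAdjoint_op J.isSelfAdjoint_op
    (Js k).velocity J.velocity (by linarith : 0 < t)
  have hv := norm_velocity_le (h.norm_le k)
  have hv' := norm_velocity_sub_le J (Js k)
  set ε := ‖J.op - (Js k).op‖
  have hε : 0 ≤ ε := norm_nonneg _
  calc _ ≤ 2 * ε + 2 * t * (2 * L) * ε := by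
        refine h1.trans (add_le_add hv' ?_)
        gcongr
    _ ≤ 6 * L * (t * ε) := by
      have h2 : ε ≤ t * ε := le_mul_of_one_le_left hε ht1
      have h3 : t * ε ≤ L * (t * ε) := le_mul_of_one_le_left (by positivity) hL
      nlinarith
    _ ≤ 6 * L * (Real.exp (η * q (k + 1) / 2) * Real.exp (-(η * q (k + 1)))) := by
      gcongr
      exact h.dist_le k
    _ = 6 * L * Real.exp (-((6 * rate L + 3) * q (k + 1))) := by
      rw [← Real.exp_add, hη]
      ring_nf
    _ ≤ _ := by
      have h4 : (q k : ℝ) ≤ q (k + 1) := by exact_mod_cast (h.strictMono (Nat.lt_succ_self k)).le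
      gcongr <;> linarith

/-- Two comparisons with `J_k` cost `6L` each, the periodic estimate costs `1 ≤ L`. The latter is
used with `τ = exp(η q_k / 6)`, and `η / 6 = 2 rate + 1` is chosen so that `exp(rate q_k) / τ` still
decays like `exp(-(rate + 1) q_k)`. This decay in turn leaves room for a second loss `exp(rate q_k)`
in the kernel argument. -/
theorem norm_meanVelocity_sub_delta_le_of_mem (hL : 1 ≤ L) (hη : η = 6 * (2 * rate L + 1))
    (h : Approximants J L η Js q) (k : ℕ) {t : ℝ} (ht0 : Real.exp (η * q k / 2) ≤ t)
    (ht : t ≤ Real.exp (η * q (k + 1) / 2)) (n : ℤ) :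
    ‖(J.meanVelocity t - J.meanVelocity (Real.exp (η * q k / 2))) (delta n)‖
      ≤ 13 * L * Real.exp (-((rate L + 1) * q k)) := by
  have hr := rate_nonneg hL
  have hη0 : 0 ≤ η := by rw [hη]; positivity
  have h1 : 1 ≤ Real.exp (η * q k / 2) := Real.one_le_exp (by positivity)
  have e1 := h.norm_meanVelocity_sub_le hL hη k (h1.trans ht0) ht
  have e2 := h.norm_meanVelocity_sub_le hL hη k h1 (ht0.trans ht)
  have e3 := norm_timeAverage_velocity_sub_delta_le hL (h.norm_le k) (h.le_a k) (h.periodic k)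
    (τ := Real.exp (η * q k / 6)) (s := Real.exp (η * q k / 2)) (t := t)
    (Real.one_le_exp (by positivity))
    (by rw [← Real.exp_nat_mul]; exact (congrArg Real.exp (by push_cast; ring)).le)
    (by rw [← Real.exp_nat_mul]; refine le_trans (congrArg Real.exp (by push_cast; ring)).le ht0) n
  rw [exp_rate_mul hL, ← Real.exp_sub,
    show rate L * q k - η * q k / 6 = -((rate L + 1) * q k) by rw [hη]; ring] at e3
  set s := Real.exp (η * q k / 2)
  set E := Real.exp (-((rate L + 1) * q k))
  have hE : 0 ≤ E := Real.exp_nonneg _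
  have a1 := (ContinuousLinearMap.le_opNorm _ (delta n)).trans
    ((mul_le_mul_of_nonneg_right e1 (norm_nonneg _)).trans_eq (by rw [norm_delta, mul_one]))
  have a2 := (ContinuousLinearMap.le_opNorm _ (delta n)).trans
    ((mul_le_mul_of_nonneg_right e2 (norm_nonneg _)).trans_eq (by rw [norm_delta, mul_one]))
  have e : (J.meanVelocity t - J.meanVelocity s) (delta n)
      = (J.meanVelocity t - (Js k).meanVelocity t) (delta n)
        + ((Js k).meanVelocity t - (Js k).meanVelocity s) (delta n)
        - (J.meanVelocity s - (Js k).meanVelocity s) (delta n) := by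
    simp only [_root_.sub_apply]
    abel
  rw [e]
  have b1 := norm_sub_le ((J.meanVelocity t - (Js k).meanVelocity t) (delta n)
        + ((Js k).meanVelocity t - (Js k).meanVelocity s) (delta n))
        ((J.meanVelocity s - (Js k).meanVelocity s) (delta n))
  have b2 := norm_add_le ((J.meanVelocity t - (Js k).meanVelocity t) (delta n))
        (((Js k).meanVelocity t - (Js k).meanVelocity s) (delta n))
  have b3 : ‖((Js k).meanVelocity t - (Js k).meanVelocity s) (delta n)‖ ≤ E := e3
  nlinarith

/-- Chain the windows: `q_{k+1} ≥ q_k + 1` makes the errors at least halve from one scale to the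
next, so the geometric series doubles `13 * L`. The induction is on the number of scales up to `t`,
with `k` free. -/
theorem norm_meanVelocity_sub_delta_le (hL : 1 ≤ L) (hη : η = 6 * (2 * rate L + 1))
    (h : Approximants J L η Js q) (k : ℕ) {t : ℝ} (ht : Real.exp (η * q k / 2) ≤ t) (n : ℤ) :
    ‖(J.meanVelocity t - J.meanVelocity (Real.exp (η * q k / 2))) (delta n)‖
      ≤ 26 * L * Real.exp (-((rate L + 1) * q k)) := by
  have hr := rate_nonneg hL
  have hη0 : 0 < η := by rw [hη]; positivity
  have key : ∀ m k : ℕ, ∀ t, Real.exp (η * q k / 2) ≤ t → t ≤ Real.exp (η * q (k + m) / 2) →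
      ‖(J.meanVelocity t - J.meanVelocity (Real.exp (η * q k / 2))) (delta n)‖
        ≤ 26 * L * Real.exp (-((rate L + 1) * q k)) := by
    intro m
    induction m with
    | zero =>
      intro k t h1 h2
      rw [le_antisymm h2 h1, add_zero, sub_self]
      simp only [_root_.zero_apply, norm_zero]
      positivity
    | succ m ih =>
      intro k t h1 h2
      have hqk : (q k : ℝ) + 1 ≤ q (k + 1) := by
        exact_mod_cast h.strictMono (Nat.lt_succ_self k)
      have hE : 0 ≤ Real.exp (-((rate L + 1) * q k)) := Real.exp_nonneg _
      rcases le_total t (Real.exp (η * q (k + 1) / 2)) with h3 | h3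
      · refine (h.norm_meanVelocity_sub_delta_le_of_mem hL hη k h1 h3 n).trans ?_
        gcongr
        norm_num
      · have i1 := ih (k + 1) t h3 (by rwa [add_assoc, add_comm 1 m])
        have i2 := h.norm_meanVelocity_sub_delta_le_of_mem hL hη k
          (t := Real.exp (η * q (k + 1) / 2)) (Real.exp_le_exp.2 (by nlinarith)) le_rfl n
        have i3 : Real.exp (-((rate L + 1) * q (k + 1)))
            ≤ Real.exp (-((rate L + 1) * q k)) * (1 / 2) := by
          calc _ ≤ Real.exp (-((rate L + 1) * q k) + -1) := Real.exp_le_exp.2 (by nlinarith)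
            _ = Real.exp (-((rate L + 1) * q k)) * Real.exp (-1) := Real.exp_add _ _
            _ ≤ _ := by
              gcongr
              rw [Real.exp_neg, ← one_div]
              exact one_div_le_one_div_of_le two_pos (by linarith [Real.add_one_le_exp 1])
        have i4 := norm_add_le
          ((J.meanVelocity t - J.meanVelocity (Real.exp (η * q (k + 1) / 2))) (delta n))
          ((J.meanVelocity (Real.exp (η * q (k + 1) / 2))
            - J.meanVelocity (Real.exp (η * q k / 2))) (delta n))
        rw [← _root_.add_apply, sub_add_sub_cancel] at i4
        nlinarith
  have hlim : Tendsto (fun m : ℕ => Real.exp (η * q (k + m) / 2)) atTop atTop := by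
    refine Real.tendsto_exp_atTop.comp ?_
    have hq : Tendsto (fun m : ℕ => (q (k + m) : ℝ)) atTop atTop :=
      tendsto_natCast_atTop_atTop.comp (h.strictMono.tendsto_atTop.comp
        (tendsto_atTop_mono (fun m => Nat.le_add_left m k) tendsto_id))
    exact (hq.const_mul_atTop hη0).atTop_div_const two_pos
  obtain ⟨m, hm⟩ := (hlim.eventually_ge_atTop t).exists
  exact key m k t ht hm

/-- The asymptotic velocity exists, and no nonzero `ℓ¹` vector is in its kernel. -/
theorem exists_asymptotic_velocity (hL : 1 ≤ L) (hη : η = 6 * (2 * rate L + 1))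
    (h : Approximants J L η Js q) :
    ∃ Q : L2Z →L[ℂ] L2Z, IsSelfAdjoint Q ∧
      (∀ φ, Tendsto (fun t => J.meanVelocity t φ) atTop (𝓝 (Q φ))) ∧
      ∀ φ : L2Z, Summable (fun n => ‖φ n‖) → Q φ = 0 → φ = 0 := by
  have hr := rate_nonneg hL
  have hη0 : 0 < η := by rw [hη]; positivity
  have hqlim : Tendsto (fun k : ℕ => (q k : ℝ)) atTop atTop :=
    tendsto_natCast_atTop_atTop.comp h.strictMono.tendsto_atTop
  have hexp : Tendsto (fun k : ℕ => Real.exp (-((rate L + 1) * q k))) atTop (𝓝 0) :=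
    Real.tendsto_exp_neg_atTop_nhds_zero.comp
      (hqlim.const_mul_atTop (by positivity : 0 < rate L + 1))
  have hb : ∀ᶠ t in atTop, ‖J.meanVelocity t‖ ≤ ‖J.velocity‖ :=
    (eventually_gt_atTop 0).mono fun t ht => norm_timeAverage_le J.isSelfAdjoint_op _ ht
  have hC : ∀ n, CauchySeq fun t => J.meanVelocity t (delta n) := fun n => by
    refine Metric.cauchySeq_iff'.2 fun ε hε => ?_
    have h1 : Tendsto (fun k : ℕ => 26 * L * Real.exp (-((rate L + 1) * q k))) atTop (𝓝 0) := by
      simpa using hexp.const_mul (26 * L)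
    obtain ⟨k, hk⟩ := (h1.eventually (gt_mem_nhds hε)).exists
    refine ⟨Real.exp (η * q k / 2), fun t ht => ?_⟩
    rw [dist_eq_norm, ← _root_.sub_apply]
    exact (h.norm_meanVelocity_sub_delta_le hL hη k ht n).trans_lt hk
  obtain ⟨Q, hQ⟩ := exists_tendsto_of_cauchy_delta hb hC
  refine ⟨Q, isSelfAdjoint_of_tendsto (fun t => isSelfAdjoint_timeAverage J.isSelfAdjoint_op
    J.isSelfAdjoint_velocity t) hQ, hQ, fun φ hφ hQφ => ?_⟩
  refine eq_zero_of_tendsto_shift_sub h.strictMono hφ ?_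
  set S := ∑' n, ‖φ n‖
  have hlim : Tendsto (fun k : ℕ => Real.exp (-(q k : ℝ)) * (26 * L * S + 6 * L * ‖φ‖ + ‖φ‖))
      atTop (𝓝 0) := by
    simpa using (Real.tendsto_exp_neg_atTop_nhds_zero.comp hqlim).mul_const
      (26 * L * S + 6 * L * ‖φ‖ + ‖φ‖)
  refine squeeze_zero (fun _ => norm_nonneg _) (fun k => ?_) hlim
  set E := Real.exp (-((rate L + 1) * q k)) with hE
  have h1 : 1 ≤ Real.exp (η * q k / 2) := Real.one_le_exp (by positivity)
  have hmono : (q k : ℝ) ≤ q (k + 1) := by exact_mod_cast (h.strictMono (Nat.lt_succ_self k)).le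
  have a1 := h.norm_meanVelocity_sub_le hL hη k h1 (Real.exp_le_exp.2 (by gcongr))
  have a2 := norm_shift_sub_shift_le hL (h.norm_le k) (h.le_a k) (h.periodic k)
    (zero_lt_one.trans_le h1) φ
  set s := Real.exp (η * q k / 2) with hs
  -- Let `t → ∞` in the tail bound: since `Q φ = 0`, the mean velocity at time `s` is itself the
  -- error. Summability of `φ` upgrades the bounds on the `δ_n`.
  have a3 : ‖J.meanVelocity s φ‖ ≤ 26 * L * E * S := by
    have b1 : Tendsto (fun t => ‖(J.meanVelocity t - J.meanVelocity s) φ‖) atTop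
        (𝓝 ‖Q φ - J.meanVelocity s φ‖) := ((hQ φ).sub_const _).norm
    rw [hQφ, zero_sub, norm_neg] at b1
    exact le_of_tendsto b1 ((eventually_ge_atTop s).mono fun t ht =>
      norm_apply_le_of_delta (h.norm_meanVelocity_sub_delta_le hL hη k ht) hφ)
  have a4 : ‖(Js k).meanVelocity s φ‖ ≤ 26 * L * E * S + 6 * L * E * ‖φ‖ := by
    have b1 := (ContinuousLinearMap.le_opNorm (J.meanVelocity s - (Js k).meanVelocity s) φ).trans
      (mul_le_mul_of_nonneg_right a1 (norm_nonneg _))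
    have b2 := norm_sub_le (J.meanVelocity s φ) ((J.meanVelocity s - (Js k).meanVelocity s) φ)
    rw [_root_.sub_apply, sub_sub_cancel] at b2
    rw [_root_.sub_apply] at b1
    linarith
  have a5 : ‖φ‖ / s ≤ E * ‖φ‖ := by
    rw [div_eq_mul_inv, mul_comm, hs, ← Real.exp_neg]
    refine mul_le_mul_of_nonneg_right (Real.exp_le_exp.2 ?_) (norm_nonneg _)
    rw [hη]
    have : (0 : ℝ) ≤ q k := Nat.cast_nonneg _
    nlinarith [mul_nonneg hr this]
  refine a2.trans ?_
  rw [exp_rate_mul hL]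
  -- The loss `exp(rate q_k)` in the periodic lower bound is beaten by `E`, with `exp(-q_k)` to
  -- spare.
  have e : Real.exp (-(q k : ℝ)) = Real.exp (rate L * q k) * E := by
    rw [hE, ← Real.exp_add]
    ring_nf
  rw [e, mul_assoc]
  refine mul_le_mul_of_nonneg_left ((add_le_add a4 a5).trans_eq ?_) (Real.exp_nonneg _)
  ring

end Approximants

end JacobiMatrix

end JacobiDynamics

/-! ### Weighted `ℓ²` norms and ballistic propagation bounds. -/

namespace JacobiDynamics

theorem hasSum_norm_sq (φ : L2Z) : HasSum (fun n => ‖φ n‖ ^ 2) (‖φ‖ ^ 2) := by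
  simpa using lp.hasSum_norm (p := 2) (by norm_num) φ

theorem memℓp_two_iff {f : ℤ → ℂ} : Memℓp f 2 ↔ Summable fun n => ‖f n‖ ^ 2 := by
  simpa using memℓp_gen_iff (p := 2) (f := f) (by norm_num)

/-- Dominated convergence in `ℓ²(ℤ)`. -/
theorem tendsto_of_dominated {f : ℕ → L2Z} {f₀ : L2Z} {g : ℤ → ℝ}
    (hg : Summable fun n => g n ^ 2) (hfg : ∀ N n, ‖f N n‖ ≤ g n)
    (h : ∀ n, Tendsto (fun N => f N n) atTop (𝓝 (f₀ n))) : Tendsto f atTop (𝓝 f₀) := by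
  have hf₀ : ∀ n, ‖f₀ n‖ ≤ g n := fun n => le_of_tendsto' (h n).norm fun N => hfg N n
  have h1 : Tendsto (fun N => ∑' n, ‖(f N - f₀) n‖ ^ 2) atTop (𝓝 (∑' _ : ℤ, (0 : ℝ))) := by
    refine tendsto_tsum_of_dominated_convergence (hg.mul_left 4) (fun n => ?_)
      (Eventually.of_forall fun N n => ?_)
    · have h2 := ((h n).sub_const (f₀ n)).norm.pow 2
      simpa using h2
    · rw [Real.norm_eq_abs, abs_of_nonneg (by positivity), lp.coeFn_sub, Pi.sub_apply]
      have h2 : ‖f N n - f₀ n‖ ≤ 2 * g n :=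
        (norm_sub_le _ _).trans (by linarith [hfg N n, hf₀ n])
      calc ‖f N n - f₀ n‖ ^ 2 ≤ (2 * g n) ^ 2 := by gcongr
        _ = 4 * g n ^ 2 := by ring
  simp only [(hasSum_norm_sq _).tsum_eq, tsum_zero] at h1
  rw [tendsto_iff_norm_sub_tendsto_zero]
  have h2 := h1.sqrt
  simpa using h2

theorem tendsto_weightedShift {c : ℕ → ℤ → ℝ} {c₀ : ℤ → ℝ} {C : ℝ}
    (hc : ∀ N, ∃ C, ∀ n, |c N n| ≤ C) (hc₀ : ∃ C, ∀ n, |c₀ n| ≤ C) (hC : ∀ N n, |c N n| ≤ C)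
    (h : ∀ n, Tendsto (fun N => c N n) atTop (𝓝 (c₀ n))) (k : ℤ) (φ : L2Z) :
    Tendsto (fun N => weightedShift (c N) (hc N) k φ) atTop (𝓝 (weightedShift c₀ hc₀ k φ)) := by
  refine tendsto_of_dominated (g := fun n => C * ‖φ (n + k)‖) ?_ (fun N n => ?_) fun n => ?_
  · have h1 : Summable fun n => ‖φ (n + k)‖ ^ 2 :=
      (Equiv.addRight k).summable_iff.2 (hasSum_norm_sq φ).summable
    simpa only [mul_pow] using h1.mul_left (C ^ 2)
  · rw [weightedShift_apply, norm_mul, Complex.norm_real]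
    exact mul_le_mul_of_nonneg_right (hC N n) (norm_nonneg _)
  · simp only [weightedShift_apply]
    exact ((Complex.continuous_ofReal.tendsto _).comp (h n)).mul_const _

/-- The operator of multiplication by a bounded real sequence. -/
def diag (w : ℤ → ℝ) (hw : ∃ C, ∀ n, |w n| ≤ C) : L2Z →L[ℂ] L2Z := weightedShift w hw 0

@[simp]
theorem diag_apply (w : ℤ → ℝ) (hw : ∃ C, ∀ n, |w n| ≤ C) (φ : L2Z) (n : ℤ) :
    diag w hw φ n = (w n : ℂ) * φ n := by
  rw [diag, weightedShift_apply, add_zero]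

/-- The weights `(1 + min(|n|, N) / T)^m`. -/
def weight (m : ℕ) (T : ℝ) (N : ℕ) (n : ℤ) : ℝ := (1 + min |(n : ℝ)| N / T) ^ m

/-- Convexity: on `[0, 1]` the power lies below its chord. -/
theorem one_add_pow_le {u : ℝ} (hu : 0 ≤ u) (hu1 : u ≤ 1) (m : ℕ) :
    (1 + u) ^ m ≤ 1 + (2 ^ m - 1) * u := by
  induction m with
  | zero => simp
  | succ m ih =>
    have h : (1 : ℝ) ≤ 2 ^ m := one_le_pow₀ one_le_two
    rw [pow_succ, pow_succ]
    nlinarith [mul_le_mul_of_nonneg_right ih (by linarith : 0 ≤ 1 + u), mul_nonneg hu hu,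
      mul_nonneg (mul_nonneg (by linarith : (0 : ℝ) ≤ 2 ^ m - 1) hu) (by linarith : 0 ≤ 1 - u)]

theorem abs_pow_sub_pow_le {x y u : ℝ} (hx : 1 ≤ x) (hy : 1 ≤ y) (h : |x - y| ≤ u) (hu1 : u ≤ 1)
    (m : ℕ) : |x ^ m - y ^ m| ≤ 2 ^ m * u * y ^ m := by
  have hu : 0 ≤ u := (abs_nonneg _).trans h
  have key : ∀ x y : ℝ, 1 ≤ y → 0 ≤ x → x - y ≤ u → x ^ m - y ^ m ≤ 2 ^ m * u * y ^ m := by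
    intro x y hy hx h
    have h1 : x ≤ y * (1 + u) := by nlinarith
    have h2 : x ^ m ≤ y ^ m * (1 + u) ^ m := by
      rw [← mul_pow]
      exact pow_le_pow_left₀ hx h1 m
    have h3 := mul_le_mul_of_nonneg_left (one_add_pow_le hu hu1 m)
      (by positivity : (0 : ℝ) ≤ y ^ m)
    have h4 : 0 ≤ y ^ m * u := by positivity
    nlinarith
  rw [abs_le] at h
  rw [abs_le]
  refine ⟨?_, key x y hy (by linarith) (by linarith)⟩
  rcases le_total x y with hxy | hxy
  · have h1 := key y x hx (by linarith) (by linarith)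
    have h2 : x ^ m ≤ y ^ m := pow_le_pow_left₀ (by linarith) hxy m
    have h3 : 2 ^ m * u * x ^ m ≤ 2 ^ m * u * y ^ m := by gcongr
    linarith
  · have h2 : y ^ m ≤ x ^ m := pow_le_pow_left₀ (by linarith) hxy m
    have h3 : 0 ≤ 2 ^ m * u * y ^ m := by positivity
    linarith

theorem one_le_weight_base {T : ℝ} (hT : 1 ≤ T) (N : ℕ) (n : ℤ) :
    1 ≤ 1 + min |(n : ℝ)| N / T := by
  have : 0 ≤ min |(n : ℝ)| N / T := div_nonneg (le_min (abs_nonneg _) (Nat.cast_nonneg _))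
    (by linarith)
  linarith

theorem one_le_weight (m : ℕ) {T : ℝ} (hT : 1 ≤ T) (N : ℕ) (n : ℤ) : 1 ≤ weight m T N n :=
  one_le_pow₀ (one_le_weight_base hT N n)

theorem weight_bounded (m : ℕ) {T : ℝ} (hT : 1 ≤ T) (N : ℕ) :
    ∃ C, ∀ n, |weight m T N n| ≤ C := by
  refine ⟨(1 + N / T) ^ m, fun n => ?_⟩
  rw [abs_of_nonneg (zero_le_one.trans (one_le_weight m hT N n)), weight]
  refine pow_le_pow_left₀ (zero_le_one.trans (one_le_weight_base hT N n)) ?_ m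
  gcongr
  exact min_le_right _ _

/-- The base of the weight is at least `1` and `1/T`-Lipschitz. The constant does not depend on the
cutoff `N`, which can therefore be removed at the end. -/
theorem abs_weight_sub_le (m : ℕ) {T : ℝ} (hT : 1 ≤ T) (N : ℕ) {n n' : ℤ} (h : |n - n'| ≤ 1) :
    |weight m T N n - weight m T N n'| ≤ 2 ^ m / T * weight m T N n' := by
  have hT0 : 0 < T := by linarith
  have h1 : |(n : ℝ) - n'| ≤ 1 := by exact_mod_cast h
  have h2 : |(1 + min |(n : ℝ)| N / T) - (1 + min |(n' : ℝ)| N / T)| ≤ 1 / T := by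
    rw [add_sub_add_left_eq_sub, ← sub_div, abs_div, abs_of_pos hT0]
    gcongr
    refine (abs_min_sub_min_le_max _ _ _ _).trans ?_
    rw [sub_self, abs_zero]
    exact max_le ((abs_abs_sub_abs_le_abs_sub _ _).trans h1) zero_le_one
  have h3 := abs_pow_sub_pow_le (one_le_weight_base hT N n) (one_le_weight_base hT N n') h2
    (by rw [div_le_one hT0]; exact hT) m
  rwa [mul_one_div] at h3

namespace JacobiMatrix

variable {J : JacobiMatrix}

theorem op_mul_diag_sub (w : ℤ → ℝ) (hw : ∃ C, ∀ n, |w n| ≤ C)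
    (h₁ : ∃ C, ∀ n, |J.a (n - 1) * (w (n - 1) - w n)| ≤ C)
    (h₂ : ∃ C, ∀ n, |J.a n * (w (n + 1) - w n)| ≤ C) :
    J.op * diag w hw - diag w hw * J.op
      = weightedShift (fun n => J.a (n - 1) * (w (n - 1) - w n)) h₁ (-1)
        + weightedShift (fun n => J.a n * (w (n + 1) - w n)) h₂ 1 := by
  ext φ n
  change J.op (diag w hw φ) n - diag w hw (J.op φ) n
    = ((J.a (n - 1) * (w (n - 1) - w n) : ℝ) : ℂ) * φ (n - 1)
      + ((J.a n * (w (n + 1) - w n) : ℝ) : ℂ) * φ (n + 1)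
  rw [op_apply, diag_apply, diag_apply, diag_apply, diag_apply, op_apply]
  push_cast
  ring

/-- Dividing by the weight at the neighbouring site writes the commutator as a bounded operator
applied to `Wφ`, the form required by the Gronwall bound `norm_apply_evolution_le`. -/
theorem norm_op_mul_diag_sub_apply_le {R κ : ℝ} (hR : ‖J.op‖ ≤ R) {w : ℤ → ℝ}
    (hw : ∃ C, ∀ n, |w n| ≤ C) (hpos : ∀ n, 0 < w n)
    (h₁ : ∀ n, |w n - w (n + 1)| ≤ κ * w n) (h₂ : ∀ n, |w (n + 1) - w n| ≤ κ * w (n + 1))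
    (φ : L2Z) :
    ‖(J.op * diag w hw - diag w hw * J.op) φ‖ ≤ 2 * R * κ * ‖diag w hw φ‖ := by
  have hR0 : 0 ≤ R := (norm_nonneg _).trans hR
  have aux : ∀ a x y : ℝ, 0 < a → a ≤ R → 0 < x → |x - y| ≤ κ * x → |a * (x - y) / x| ≤ R * κ := by
    intro a x y ha haR hx hxy
    rw [abs_div, abs_mul, abs_of_pos ha, abs_of_pos hx, div_le_iff₀ hx, mul_assoc]
    exact mul_le_mul haR hxy (abs_nonneg _) hR0
  have b₁ : ∀ n, |J.a (n - 1) * (w (n - 1) - w n) / w (n - 1)| ≤ R * κ := fun n => by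
    have h := h₁ (n - 1)
    rw [sub_add_cancel] at h
    exact aux _ _ _ (J.a_pos' _) (a_le_of_norm_le hR _) (hpos _) h
  have b₂ : ∀ n, |J.a n * (w (n + 1) - w n) / w (n + 1)| ≤ R * κ := fun n =>
    aux _ _ _ (J.a_pos' _) (a_le_of_norm_le hR _) (hpos _) (h₂ n)
  have e : (J.op * diag w hw - diag w hw * J.op) φ
      = weightedShift (fun n => J.a (n - 1) * (w (n - 1) - w n) / w (n - 1)) ⟨_, b₁⟩ (-1)
          (diag w hw φ)
        + weightedShift (fun n => J.a n * (w (n + 1) - w n) / w (n + 1)) ⟨_, b₂⟩ 1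
          (diag w hw φ) := by
    ext n
    have hn₁ : (w (n - 1) : ℂ) ≠ 0 := by exact_mod_cast (hpos _).ne'
    have hn₂ : (w (n + 1) : ℂ) ≠ 0 := by exact_mod_cast (hpos _).ne'
    change J.op (diag w hw φ) n - diag w hw (J.op φ) n
      = ((J.a (n - 1) * (w (n - 1) - w n) / w (n - 1) : ℝ) : ℂ) * diag w hw φ (n - 1)
        + ((J.a n * (w (n + 1) - w n) / w (n + 1) : ℝ) : ℂ) * diag w hw φ (n + 1)
    rw [op_apply, diag_apply, diag_apply, diag_apply, diag_apply, op_apply]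
    push_cast
    field_simp
    ring
  rw [e]
  have c₁ := ContinuousLinearMap.le_of_opNorm_le _
    (norm_weightedShift_le ⟨_, b₁⟩ (-1) b₁) (diag w hw φ)
  have c₂ := ContinuousLinearMap.le_of_opNorm_le _
    (norm_weightedShift_le ⟨_, b₂⟩ 1 b₂) (diag w hw φ)
  refine (norm_add_le _ _).trans ((add_le_add c₁ c₂).trans_eq ?_)
  ring

/-- Weighted `ℓ²` norms of `e^{-itJ}φ` stay bounded on the scale `T` for times of order `T`. -/
theorem weighted_propagator_bound {R : ℝ} (hR : ‖J.op‖ ≤ R) (m : ℕ) {T : ℝ} (hT : 1 ≤ T)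
    {φ : L2Z} (hφ : Summable fun n : ℤ => (1 + |(n : ℝ)|) ^ (2 * m) * ‖φ n‖ ^ 2) (t : ℝ) :
    (Summable fun n : ℤ => (1 + |(n : ℝ)| / T) ^ (2 * m) * ‖J.propagator t φ n‖ ^ 2) ∧
      ∑' n : ℤ, (1 + |(n : ℝ)| / T) ^ (2 * m) * ‖J.propagator t φ n‖ ^ 2
        ≤ Real.exp (4 * R * 2 ^ m / T * |t|)
          * ∑' n : ℤ, (1 + |(n : ℝ)|) ^ (2 * m) * ‖φ n‖ ^ 2 := by
  have hT0 : 0 < T := by linarith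
  set S := ∑' n : ℤ, (1 + |(n : ℝ)|) ^ (2 * m) * ‖φ n‖ ^ 2
  have hnn : ∀ n : ℤ, 0 ≤ (1 + |(n : ℝ)| / T) ^ (2 * m) * ‖J.propagator t φ n‖ ^ 2 :=
    fun n => by positivity
  have hsq : ∀ N n (ψ : L2Z), ‖diag (weight m T N) (weight_bounded m hT N) ψ n‖ ^ 2
      = (1 + min |(n : ℝ)| N / T) ^ (2 * m) * ‖ψ n‖ ^ 2 := fun N n ψ => by
    rw [diag_apply, norm_mul, mul_pow, Complex.norm_real, Real.norm_eq_abs, sq_abs, weight,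
      ← pow_mul, mul_comm m 2]
  have hW : ∀ N, ‖diag (weight m T N) (weight_bounded m hT N) (J.propagator t φ)‖ ^ 2
      ≤ Real.exp (4 * R * 2 ^ m / T * |t|) * S := fun N => by
    have hpos : ∀ n, 0 < weight m T N n := fun n => zero_lt_one.trans_le (one_le_weight m hT N n)
    have h1 := norm_apply_evolution_le J.isSelfAdjoint_op
      (norm_op_mul_diag_sub_apply_le hR (weight_bounded m hT N) hpos
        (κ := 2 ^ m / T)
        (fun n => by rw [abs_sub_comm]; exact abs_weight_sub_le m hT N (by simp))
        (fun n => by rw [abs_sub_comm]; exact abs_weight_sub_le m hT N (by simp))) φ t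
    have h2 : ‖diag (weight m T N) (weight_bounded m hT N) φ‖ ^ 2 ≤ S := by
      rw [← (hasSum_norm_sq _).tsum_eq]
      refine (hasSum_norm_sq _).summable.tsum_le_tsum (fun n => ?_) hφ
      rw [hsq]
      have h3 : min |(n : ℝ)| N / T ≤ |(n : ℝ)| :=
        (div_le_self (le_min (abs_nonneg _) (Nat.cast_nonneg _)) hT).trans (min_le_left _ _)
      have := one_le_weight_base hT N n
      gcongr
    calc _ ≤ (‖diag (weight m T N) (weight_bounded m hT N) φ‖
          * Real.exp (2 * R * (2 ^ m / T) * |t|)) ^ 2 := by gcongr; exact h1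
      _ = Real.exp (4 * R * 2 ^ m / T * |t|)
          * ‖diag (weight m T N) (weight_bounded m hT N) φ‖ ^ 2 := by
        rw [mul_pow, ← Real.exp_nat_mul, mul_comm]
        congr 2
        push_cast
        ring
      _ ≤ _ := by gcongr
  -- On a finite set the cutoff is inactive once `N` exceeds all `|n|`, so the uniform bound passes
  -- to the full weight.
  have hfin : ∀ s : Finset ℤ, ∑ n ∈ s, (1 + |(n : ℝ)| / T) ^ (2 * m) * ‖J.propagator t φ n‖ ^ 2
      ≤ Real.exp (4 * R * 2 ^ m / T * |t|) * S := fun s => by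
    have hN : ∀ n ∈ s, |(n : ℝ)| ≤ (s.sup Int.natAbs : ℕ) := fun n hn => by
      rw [← Int.cast_abs, Int.abs_eq_natAbs, Int.cast_natCast]
      exact_mod_cast Finset.le_sup (f := Int.natAbs) hn
    refine le_trans ?_ (hW (s.sup Int.natAbs))
    rw [← (hasSum_norm_sq _).tsum_eq]
    refine le_trans (Finset.sum_le_sum fun n hn => ?_)
      ((hasSum_norm_sq _).summable.sum_le_tsum s fun n _ => by positivity)
    rw [hsq, min_eq_left (hN n hn)]
  exact ⟨summable_of_sum_le hnn hfin, Real.tsum_le_of_sum_le hnn hfin⟩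

end JacobiMatrix

end JacobiDynamics

/-! ### The position operator in the Heisenberg picture. -/

namespace JacobiDynamics

/-- `e^{itH} X e^{-itH} x = X x + t M_t x`, where the possibly unbounded `X` is approximated by
bounded operators `W_N` and `M_t` is the time average of `A = i[H, X]`. -/
theorem evolution_neg_apply_eq_add_timeAverage {E : Type*} [NormedAddCommGroup E]
    [InnerProductSpace ℂ E] [CompleteSpace E] {H A : E →L[ℂ] E} (hH : IsSelfAdjoint H)
    {W : ℕ → E →L[ℂ] E} {C t : ℝ} (ht : 0 < t) (hC : ∀ N, ‖commI H (W N)‖ ≤ C)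
    (hlim : ∀ x, Tendsto (fun N => commI H (W N) x) atTop (𝓝 (A x))) {x y z : E}
    (hy : Tendsto (fun N => W N x) atTop (𝓝 y))
    (hz : Tendsto (fun N => W N (evolution H t x)) atTop (𝓝 z)) :
    evolution H (-t) z = y + (t : ℂ) • timeAverage H A t x := by
  have happ : ∀ B : E →L[ℂ] E, (∫ s in (0 : ℝ)..t, conj H B s) x
      = ∫ s in (0 : ℝ)..t, conj H B s x := fun B =>
    (((ContinuousLinearMap.apply ℂ E x).restrictScalars ℝ).intervalIntegral_comp_comm
      (intervalIntegrable_conj H B 0 t)).symm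
  have h1 : ∀ N, evolution H (-t) (W N (evolution H t x))
      = W N x + ∫ s in (0 : ℝ)..t, conj H (commI H (W N)) s x := fun N => by
    rw [← happ, integral_conj_commI, _root_.sub_apply, add_sub_cancel]
    rfl
  have h2 : Tendsto (fun N => evolution H (-t) (W N (evolution H t x))) atTop
      (𝓝 (evolution H (-t) z)) :=
    ((evolution H (-t)).continuous.tendsto _).comp hz
  have h3 : Tendsto (fun N => ∫ s in (0 : ℝ)..t, conj H (commI H (W N)) s x)
      atTop (𝓝 (∫ s in (0 : ℝ)..t, conj H A s x)) := by
    refine intervalIntegral.tendsto_integral_filter_of_dominated_convergence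
      (fun _ => C * ‖x‖) (Eventually.of_forall fun N => ?_)
      (Eventually.of_forall fun N => Eventually.of_forall fun s _ => ?_)
      intervalIntegrable_const (Eventually.of_forall fun s _ => ?_)
    · exact (((ContinuousLinearMap.apply ℂ E x).continuous.comp
        (continuous_conj _ _))).aestronglyMeasurable
    · exact ContinuousLinearMap.le_of_opNorm_le _ ((norm_conj_le hH _ s).trans (hC N)) _
    · exact ((evolution H (-s)).continuous.tendsto _).comp (hlim (evolution H s x))
  have h4 : (t : ℂ) • timeAverage H A t x = ∫ s in (0 : ℝ)..t, conj H A s x := by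
    rw [timeAverage, _root_.smul_apply, happ, Complex.coe_smul, smul_smul,
      mul_inv_cancel₀ ht.ne', one_smul]
  rw [h4]
  refine tendsto_nhds_unique h2 ?_
  simp only [h1]
  exact hy.add h3

theorem mem_position_domain_iff {φ : L2Z} :
    φ ∈ position.domain ↔ Summable fun n : ℤ => (n : ℝ) ^ 2 * ‖φ n‖ ^ 2 := by
  change Memℓp (fun n : ℤ => (n : ℂ) * φ n) 2 ↔ _
  rw [memℓp_two_iff]
  refine summable_congr fun n => ?_
  rw [norm_mul, mul_pow, Complex.norm_intCast, sq_abs]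

/-- `D(X)` in the form of `weighted_propagator_bound` with `m = 1`, which gives its invariance under
the propagator. -/
theorem mem_position_domain_iff' {φ : L2Z} :
    φ ∈ position.domain ↔ Summable fun n : ℤ => (1 + |(n : ℝ)|) ^ (2 * 1) * ‖φ n‖ ^ 2 := by
  rw [mem_position_domain_iff]
  refine ⟨fun h => ?_, fun h => ?_⟩
  · refine Summable.of_nonneg_of_le (fun n => by positivity) (fun n => ?_)
      (((hasSum_norm_sq φ).summable.mul_left 2).add (h.mul_left 2))
    rw [← mul_assoc, ← add_mul, mul_one]
    refine mul_le_mul_of_nonneg_right ?_ (by positivity)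
    rw [← sq_abs (n : ℝ)]
    nlinarith [sq_nonneg (1 - |(n : ℝ)|)]
  · refine Summable.of_nonneg_of_le (fun n => by positivity) (fun n => ?_) h
    rw [mul_one]
    refine mul_le_mul_of_nonneg_right ?_ (by positivity)
    rw [← sq_abs (n : ℝ)]
    nlinarith [abs_nonneg (n : ℝ)]

theorem position_apply (φ : position.domain) (n : ℤ) : position φ n = (n : ℂ) * φ.1 n := rfl

/-- Truncation of the integers to `[-N, N]`. -/
def clamp (N : ℕ) (n : ℤ) : ℝ := max (-N) (min n N)

theorem abs_clamp_le (N : ℕ) (n : ℤ) : |clamp N n| ≤ N := by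
  have h : (0 : ℝ) ≤ N := Nat.cast_nonneg _
  exact abs_le.2 ⟨le_max_left _ _, max_le (by linarith) (min_le_right _ _)⟩

theorem abs_clamp_le_abs (N : ℕ) (n : ℤ) : |clamp N n| ≤ |(n : ℝ)| := by
  have h : (0 : ℝ) ≤ N := Nat.cast_nonneg _
  rw [clamp]
  refine abs_le.2 ⟨?_, ?_⟩
  · refine le_trans ?_ (le_max_right _ _)
    exact le_min (neg_abs_le _) ((neg_nonpos.2 (abs_nonneg _)).trans h)
  · exact max_le ((neg_nonpos.2 h).trans (abs_nonneg _)) ((min_le_left _ _).trans (le_abs_self _))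

theorem abs_clamp_sub_le (N : ℕ) (m n : ℤ) : |clamp N m - clamp N n| ≤ |(m : ℝ) - n| := by
  rw [clamp, clamp]
  refine (abs_max_sub_max_le_max _ _ _ _).trans ?_
  rw [sub_self, abs_zero]
  refine max_le (abs_nonneg _) ((abs_min_sub_min_le_max _ _ _ _).trans ?_)
  rw [sub_self, abs_zero]
  exact max_le le_rfl (abs_nonneg _)

theorem clamp_eventually_eq (n : ℤ) : ∀ᶠ N : ℕ in atTop, clamp N n = n := by
  filter_upwards [eventually_ge_atTop n.natAbs] with N hN
  have h1 : |(n : ℝ)| ≤ N := by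
    rw [← Int.cast_abs, Int.abs_eq_natAbs, Int.cast_natCast]
    exact_mod_cast hN
  obtain ⟨h2, h3⟩ := abs_le.1 h1
  rw [clamp, min_eq_left h3, max_eq_right h2]

/-- The truncated position operator. -/
def positionTrunc (N : ℕ) : L2Z →L[ℂ] L2Z := diag (clamp N) ⟨N, abs_clamp_le N⟩

theorem positionTrunc_apply (N : ℕ) (φ : L2Z) (n : ℤ) :
    positionTrunc N φ n = (clamp N n : ℂ) * φ n := diag_apply _ _ _ _

theorem tendsto_positionTrunc (φ : position.domain) :
    Tendsto (fun N => positionTrunc N φ.1) atTop (𝓝 (position φ)) := by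
  refine tendsto_of_dominated (g := fun n => |(n : ℝ)| * ‖φ.1 n‖) ?_ (fun N n => ?_) fun n => ?_
  · simpa only [mul_pow, sq_abs] using mem_position_domain_iff.1 φ.2
  · rw [positionTrunc_apply, norm_mul, Complex.norm_real, Real.norm_eq_abs]
    exact mul_le_mul_of_nonneg_right (abs_clamp_le_abs N n) (norm_nonneg _)
  · refine tendsto_const_nhds.congr' ((clamp_eventually_eq n).mono fun N hN => ?_)
    beta_reduce
    rw [positionTrunc_apply, hN, position_apply]
    push_cast
    rfl

namespace JacobiMatrix

variable {J : JacobiMatrix}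

theorem propagator_mem_domain (J : JacobiMatrix) (t : ℝ) {φ : L2Z} (hφ : φ ∈ position.domain) :
    J.propagator t φ ∈ position.domain := by
  have h := (weighted_propagator_bound (le_refl ‖J.op‖) 1 le_rfl
    (mem_position_domain_iff'.1 hφ) t).1
  simp only [div_one] at h
  exact mem_position_domain_iff'.2 h

theorem propagator_neg_apply_propagator (J : JacobiMatrix) (t : ℝ) (φ : L2Z) :
    J.propagator (-t) (J.propagator t φ) = φ := by
  have h := evolution_neg_mul_self J.op t
  exact congrArg (fun T : L2Z →L[ℂ] L2Z => T φ) h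

theorem heisenberg_domain (J : JacobiMatrix) (t : ℝ) :
    (J.heisenberg t).domain = position.domain := by
  ext φ
  change J.propagator t φ ∈ position.domain ↔ _
  refine ⟨fun h => ?_, J.propagator_mem_domain t⟩
  have h1 := J.propagator_mem_domain (-t) h
  rwa [propagator_neg_apply_propagator] at h1

/-- The clamp is `1`-Lipschitz, so the commutators are bounded uniformly in `N`; each of their
coefficients eventually equals that of the velocity. -/
theorem commI_positionTrunc (J : JacobiMatrix) :
    ∃ C, (∀ N, ‖commI J.op (positionTrunc N)‖ ≤ C) ∧
      ∀ φ, Tendsto (fun N => commI J.op (positionTrunc N) φ) atTop (𝓝 (J.velocity φ)) := by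
  set R := ‖J.op‖
  have hR : 0 ≤ R := norm_nonneg _
  have ha : ∀ n, |J.a n| ≤ R := fun n => by
    rw [abs_of_pos (J.a_pos' n)]; exact a_le_of_norm_le le_rfl n
  have b₁ : ∀ N n, |J.a (n - 1) * (clamp N (n - 1) - clamp N n)| ≤ R := fun N n => by
    have h := abs_clamp_sub_le N (n - 1) n
    rw [abs_mul]
    refine (mul_le_mul (ha _) (h.trans (le_of_eq ?_)) (abs_nonneg _) hR).trans_eq (mul_one R)
    push_cast
    rw [sub_sub_cancel_left, abs_neg, abs_one]
  have b₂ : ∀ N n, |J.a n * (clamp N (n + 1) - clamp N n)| ≤ R := fun N n => by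
    have h := abs_clamp_sub_le N (n + 1) n
    rw [abs_mul]
    refine (mul_le_mul (ha _) (h.trans (le_of_eq ?_)) (abs_nonneg _) hR).trans_eq (mul_one R)
    push_cast
    rw [add_sub_cancel_left, abs_one]
  have e : ∀ N, commI J.op (positionTrunc N) = Complex.I •
      (weightedShift (fun n => J.a (n - 1) * (clamp N (n - 1) - clamp N n)) ⟨R, b₁ N⟩ (-1)
        + weightedShift (fun n => J.a n * (clamp N (n + 1) - clamp N n)) ⟨R, b₂ N⟩ 1) := fun N => by
    rw [commI, positionTrunc, op_mul_diag_sub]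
  refine ⟨R + R, fun N => ?_, fun φ => ?_⟩
  · rw [e, norm_smul, Complex.norm_I, one_mul]
    exact (norm_add_le _ _).trans (add_le_add (norm_weightedShift_le _ _ (b₁ N))
      (norm_weightedShift_le _ _ (b₂ N)))
  · have t₁ := tendsto_weightedShift (c₀ := fun n => -J.a (n - 1)) (fun N => ⟨R, b₁ N⟩)
      ⟨R, fun n => by rw [abs_neg]; exact ha _⟩ b₁ (fun n => tendsto_const_nhds.congr' (by
        filter_upwards [clamp_eventually_eq (n - 1), clamp_eventually_eq n] with N h1 h2
        rw [h1, h2]; push_cast; ring)) (-1) φ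
    have t₂ := tendsto_weightedShift (c₀ := J.a) (fun N => ⟨R, b₂ N⟩)
      ⟨R, ha⟩ b₂ (fun n => tendsto_const_nhds.congr' (by
        filter_upwards [clamp_eventually_eq (n + 1), clamp_eventually_eq n] with N h1 h2
        rw [h1, h2]; push_cast; ring)) 1 φ
    simp only [e, _root_.smul_apply, _root_.add_apply]
    convert (t₁.add t₂).const_smul Complex.I using 2
    ext n
    rw [velocity_apply]
    change _ = Complex.I * (((-J.a (n - 1) : ℝ) : ℂ) * φ (n - 1) + (J.a n : ℂ) * φ (n + 1))
    push_cast
    ring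

/-- `X_J(t) φ = X φ + t M_t φ` for `φ ∈ D(X)`, where `M_t` is the mean velocity. -/
theorem heisenberg_apply_eq (J : JacobiMatrix) {t : ℝ} (ht : 0 < t) (φ : position.domain)
    (hφ : φ.1 ∈ (J.heisenberg t).domain) :
    J.heisenberg t ⟨φ.1, hφ⟩ = position φ + (t : ℂ) • J.meanVelocity t φ.1 := by
  obtain ⟨C, hC, hlim⟩ := J.commI_positionTrunc
  exact evolution_neg_apply_eq_add_timeAverage J.isSelfAdjoint_op ht hC hlim
    (tendsto_positionTrunc φ) (tendsto_positionTrunc ⟨_, hφ⟩)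

theorem tendsto_inv_smul_heisenberg {Q : L2Z →L[ℂ] L2Z}
    (hQ : ∀ φ, Tendsto (fun t => J.meanVelocity t φ) atTop (𝓝 (Q φ))) (φ : position.domain)
    (hφ : ∀ t, φ.1 ∈ (J.heisenberg t).domain) :
    Tendsto (fun t : ℝ => ((t⁻¹ : ℝ) : ℂ) • J.heisenberg t ⟨φ.1, hφ t⟩) atTop (𝓝 (Q φ.1)) := by
  have h : Tendsto (fun t : ℝ => ((t⁻¹ : ℝ) : ℂ) • position φ) atTop (𝓝 0) := by
    have h1 : Tendsto (fun t : ℝ => ((t⁻¹ : ℝ) : ℂ)) atTop (𝓝 0) := by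
      exact_mod_cast (Complex.continuous_ofReal.tendsto 0).comp tendsto_inv_atTop_zero
    simpa using h1.smul_const (position φ)
  have h2 := h.add (hQ φ.1)
  rw [zero_add] at h2
  refine h2.congr' ((eventually_gt_atTop 0).mono fun t ht => ?_)
  have ht' : (t : ℂ) ≠ 0 := by exact_mod_cast ht.ne'
  beta_reduce
  rw [heisenberg_apply_eq J ht, smul_add, smul_smul, Complex.ofReal_inv, inv_mul_cancel₀ ht',
    one_smul]

theorem norm_heisenberg_apply_sq (J : JacobiMatrix) (t : ℝ) (φ : L2Z)
    (hφ : φ ∈ (J.heisenberg t).domain) :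
    ‖J.heisenberg t ⟨φ, hφ⟩‖ ^ 2 = ∑' n : ℤ, (n : ℝ) ^ 2 * ‖J.propagator t φ n‖ ^ 2 := by
  have h : ‖J.heisenberg t ⟨φ, hφ⟩‖ = ‖position ⟨J.propagator t φ, hφ⟩‖ :=
    norm_evolution_apply J.isSelfAdjoint_op (-t) _
  rw [h, ← (hasSum_norm_sq _).tsum_eq]
  refine tsum_congr fun n => ?_
  rw [position_apply, norm_mul, mul_pow, Complex.norm_intCast, sq_abs]

theorem hasSum_norm_propagator_sq (J : JacobiMatrix) (t : ℝ) (φ : L2Z) :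
    HasSum (fun n : ℤ => ‖J.propagator t φ n‖ ^ 2) (‖φ‖ ^ 2) := by
  have h : ‖J.propagator t φ‖ = ‖φ‖ := norm_evolution_apply J.isSelfAdjoint_op t φ
  rw [← h]
  exact hasSum_norm_sq _

end JacobiMatrix

theorem IsSchwartz.summable_norm {φ : L2Z} (hφ : IsSchwartz φ) : Summable fun n => ‖φ n‖ := by
  refine Summable.of_norm_bounded_eventually (hφ 1 one_pos) ?_
  filter_upwards [(Set.finite_singleton (0 : ℤ)).compl_mem_cofinite] with n hn
  have h : (1 : ℝ) ≤ |(n : ℝ)| := by exact_mod_cast Int.one_le_abs hn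
  rw [norm_norm, Real.rpow_one]
  exact le_mul_of_one_le_left (norm_nonneg _) h

/-- One factor `‖φ n‖` is bounded by `‖φ‖`, since the Schwartz condition is linear in `‖φ n‖`. The
site `n = 0`, where the Schwartz weight vanishes, is excluded from the comparison. -/
theorem IsSchwartz.summable_weight {φ : L2Z} (hφ : IsSchwartz φ) {m : ℕ} (hm : 0 < m) :
    Summable fun n : ℤ => (1 + |(n : ℝ)|) ^ (2 * m) * ‖φ n‖ ^ 2 := by
  have h := (hφ ((2 * m : ℕ) : ℝ) (by positivity)).mul_left (2 ^ (2 * m) * ‖φ‖)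
  refine Summable.of_norm_bounded_eventually h ?_
  filter_upwards [(Set.finite_singleton (0 : ℤ)).compl_mem_cofinite] with n hn
  have h1 : (1 : ℝ) ≤ |(n : ℝ)| := by exact_mod_cast Int.one_le_abs hn
  rw [Real.norm_eq_abs, abs_of_nonneg (by positivity), Real.rpow_natCast]
  have h2 : (1 + |(n : ℝ)|) ^ (2 * m) ≤ 2 ^ (2 * m) * |(n : ℝ)| ^ (2 * m) := by
    rw [← mul_pow]
    gcongr
    linarith
  have h3 : ‖φ n‖ ^ 2 ≤ ‖φ‖ * ‖φ n‖ := by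
    rw [sq]
    exact mul_le_mul_of_nonneg_right (norm_apply_coord_le φ n) (norm_nonneg _)
  calc _ ≤ 2 ^ (2 * m) * |(n : ℝ)| ^ (2 * m) * (‖φ‖ * ‖φ n‖) := by gcongr
    _ = _ := by ring

theorem IsSchwartz.mem_domain {φ : L2Z} (hφ : IsSchwartz φ) : φ ∈ position.domain :=
  mem_position_domain_iff'.2 (hφ.summable_weight one_pos)

end JacobiDynamics

/-! ### Moments and transport exponents. -/

namespace JacobiDynamics

namespace JacobiMatrix

variable {J : JacobiMatrix}

/-- Ballistic upper bound: on the time scale `t`, all moments of `|n|/t` stay bounded. -/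
theorem exists_scaled_moment_bound (J : JacobiMatrix) {φ : L2Z} (hφ : IsSchwartz φ) {m : ℕ}
    (hm : 0 < m) : ∃ C, 0 < C ∧ ∀ t : ℝ, 1 ≤ t →
      (Summable fun n : ℤ => (1 + |(n : ℝ)| / t) ^ (2 * m) * ‖J.propagator t φ n‖ ^ 2) ∧
      ∑' n : ℤ, (1 + |(n : ℝ)| / t) ^ (2 * m) * ‖J.propagator t φ n‖ ^ 2 ≤ C := by
  set S := ∑' n : ℤ, (1 + |(n : ℝ)|) ^ (2 * m) * ‖φ n‖ ^ 2
  have hS : 0 ≤ S := tsum_nonneg fun n => by positivity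
  refine ⟨Real.exp (4 * ‖J.op‖ * 2 ^ m) * S + 1, by positivity, fun t ht => ?_⟩
  obtain ⟨h1, h2⟩ := weighted_propagator_bound (le_refl ‖J.op‖) m ht (hφ.summable_weight hm) t
  refine ⟨h1, h2.trans ?_⟩
  -- With the scale `T = t`, the Gronwall exponent no longer depends on `t`.
  rw [abs_of_pos (by linarith : 0 < t), div_mul_cancel₀ _ (by linarith : t ≠ 0)]
  exact le_add_of_nonneg_right zero_le_one

/-- The `p`-th moment as a real number. -/
def realMoment (J : JacobiMatrix) (p : ℝ) (φ : L2Z) (t : ℝ) : ℝ :=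
  ∑' n : ℤ, (|(n : ℝ)| ^ p + 1) * ‖J.propagator t φ n‖ ^ 2

theorem exists_realMoment_le (J : JacobiMatrix) {φ : L2Z} (hφ : IsSchwartz φ) {p : ℝ}
    (hp : 0 < p) : ∃ C, 0 < C ∧ ∀ t : ℝ, 1 ≤ t →
      (Summable fun n : ℤ => (|(n : ℝ)| ^ p + 1) * ‖J.propagator t φ n‖ ^ 2) ∧
      J.realMoment p φ t ≤ C * t ^ p := by
  set m := ⌈p⌉₊
  have hm : 0 < m := Nat.ceil_pos.2 hp
  have hpm : p ≤ ((2 * m : ℕ) : ℝ) := by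
    have h1 : p ≤ m := Nat.le_ceil p
    push_cast
    linarith [(Nat.cast_nonneg m : (0 : ℝ) ≤ m)]
  obtain ⟨C, hC, h⟩ := J.exists_scaled_moment_bound hφ hm
  refine ⟨2 * C, by positivity, fun t ht => ?_⟩
  have ht0 : 0 < t := by linarith
  obtain ⟨h1, h2⟩ := h t ht
  have htp : 1 ≤ t ^ p := Real.one_le_rpow ht hp.le
  have hle : ∀ n : ℤ, (|(n : ℝ)| ^ p + 1) * ‖J.propagator t φ n‖ ^ 2
      ≤ 2 * t ^ p * ((1 + |(n : ℝ)| / t) ^ (2 * m) * ‖J.propagator t φ n‖ ^ 2) := fun n => by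
    rw [← mul_assoc]
    refine mul_le_mul_of_nonneg_right ?_ (by positivity)
    have hx : 0 ≤ |(n : ℝ)| / t := by positivity
    have b1 : |(n : ℝ)| ^ p ≤ t ^ p * (1 + |(n : ℝ)| / t) ^ (2 * m) := by
      calc |(n : ℝ)| ^ p = t ^ p * (|(n : ℝ)| / t) ^ p := by
            rw [← Real.mul_rpow ht0.le hx, mul_div_cancel₀ _ ht0.ne']
        _ ≤ t ^ p * (1 + |(n : ℝ)| / t) ^ p := by gcongr; linarith
        _ ≤ t ^ p * (1 + |(n : ℝ)| / t) ^ ((2 * m : ℕ) : ℝ) := by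
            gcongr
            linarith
        _ = _ := by rw [Real.rpow_natCast]
    have b2 : 1 ≤ t ^ p * (1 + |(n : ℝ)| / t) ^ (2 * m) :=
      one_le_mul_of_one_le_of_one_le htp (one_le_pow₀ (by linarith))
    linarith
  have hs : Summable fun n : ℤ => (|(n : ℝ)| ^ p + 1) * ‖J.propagator t φ n‖ ^ 2 :=
    Summable.of_nonneg_of_le (fun n => by positivity) hle (h1.mul_left _)
  refine ⟨hs, (hs.tsum_le_tsum hle (h1.mul_left _)).trans ?_⟩
  rw [tsum_mul_left]
  calc _ ≤ 2 * t ^ p * C := by gcongr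
    _ = _ := by ring

/-- One term for each range: `x ≤ b`, `x ≥ B`, and the middle, where `x^p ≥ b^p` and `x² ≤ B²`. This
covers every `p > 0`, including `p < 2`, where the second moment alone gives no lower bound. -/
theorem sq_le_add_rpow {x b B p : ℝ} (hx : 0 ≤ x) (hb : 0 < b) (hB : 0 < B) (hp : 0 < p) :
    x ^ 2 ≤ b ^ 2 + x ^ 4 / B ^ 2 + B ^ 2 * (b ^ p)⁻¹ * x ^ p := by
  have h0 : 0 ≤ x ^ 4 / B ^ 2 := by positivity
  have h1 : 0 ≤ B ^ 2 * (b ^ p)⁻¹ * x ^ p := by positivity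
  have h2 : 0 ≤ b ^ 2 := by positivity
  rcases le_total x b with h | h
  · have : x ^ 2 ≤ b ^ 2 := by gcongr
    linarith
  rcases le_total x B with h' | h'
  · have h3 : b ^ p ≤ x ^ p := by gcongr
    have h4 : 0 < b ^ p := by positivity
    have h5 : B ^ 2 ≤ B ^ 2 * (b ^ p)⁻¹ * x ^ p := by
      rw [mul_assoc]
      refine le_mul_of_one_le_right (by positivity) ?_
      rw [inv_mul_eq_div, one_le_div h4]
      exact h3
    have h6 : x ^ 2 ≤ B ^ 2 := by gcongr
    linarith
  · have h3 : x ^ 2 ≤ x ^ 4 / B ^ 2 := by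
      rw [le_div_iff₀ (by positivity), show x ^ 4 = x ^ 2 * x ^ 2 by ring]
      gcongr
    linarith

theorem exists_le_realMoment {Q : L2Z →L[ℂ] L2Z}
    (hQ : ∀ φ, Tendsto (fun t => J.meanVelocity t φ) atTop (𝓝 (Q φ))) {φ : L2Z}
    (hφ : IsSchwartz φ) (hQφ : Q φ ≠ 0) {p : ℝ} (hp : 0 < p) :
    ∃ c, 0 < c ∧ ∀ᶠ t : ℝ in atTop, c * t ^ p ≤ J.realMoment p φ t := by
  have hdom : ∀ t, φ ∈ (J.heisenberg t).domain := fun t => by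
    rw [heisenberg_domain]; exact hφ.mem_domain
  have hlim := (tendsto_inv_smul_heisenberg hQ ⟨φ, hφ.mem_domain⟩ hdom).norm
  set v := ‖Q φ‖
  have hv : 0 < v := norm_pos_iff.2 hQφ
  obtain ⟨C, hC, hC'⟩ := J.exists_scaled_moment_bound hφ (m := 2) two_pos
  obtain ⟨D, hD, hD'⟩ := J.exists_realMoment_le hφ hp
  have hφ0 : 0 < ‖φ‖ := norm_pos_iff.2 fun h => hQφ (by rw [h, map_zero])
  -- The rescaled second moment is eventually at least `v² / 4`. `b` and `B` are chosen so that the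
  -- parts near the origin and far out take at most `v² / 16` each, leaving `v² / 8` for the `p`-th
  -- moment.
  set b := v / (4 * ‖φ‖) with hb_def
  have hb : 0 < b := by positivity
  set B := 4 * √C / v with hB_def
  have hB : 0 < B := by positivity
  have hb2 : b ^ 2 * ‖φ‖ ^ 2 = v ^ 2 / 16 := by rw [hb_def]; field_simp; norm_num
  have hB2 : C / B ^ 2 = v ^ 2 / 16 := by
    rw [hB_def, div_pow, mul_pow, Real.sq_sqrt hC.le]; field_simp; norm_num
  refine ⟨v ^ 2 / 8 / (B ^ 2 * (b ^ p)⁻¹), by positivity, ?_⟩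
  filter_upwards [hlim.eventually (lt_mem_nhds (by linarith : v / 2 < v)), eventually_ge_atTop 1]
    with t ht ht1
  have ht0 : 0 < t := by linarith
  obtain ⟨s4, m4⟩ := hC' t ht1
  obtain ⟨sp, -⟩ := hD' t ht1
  have s0 := J.hasSum_norm_propagator_sq t φ
  have h2 : v ^ 2 / 4 ≤ ∑' n : ℤ, (|(n : ℝ)| / t) ^ 2 * ‖J.propagator t φ n‖ ^ 2 := by
    have e : ∑' n : ℤ, (|(n : ℝ)| / t) ^ 2 * ‖J.propagator t φ n‖ ^ 2
        = ‖((t⁻¹ : ℝ) : ℂ) • J.heisenberg t ⟨φ, hdom t⟩‖ ^ 2 := by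
      rw [norm_smul, mul_pow, norm_heisenberg_apply_sq, ← tsum_mul_left]
      refine tsum_congr fun n => ?_
      rw [Complex.norm_real, Real.norm_eq_abs, sq_abs, div_pow, sq_abs]
      ring
    rw [e]
    calc v ^ 2 / 4 = (v / 2) ^ 2 := by ring
      _ ≤ _ := by gcongr
  have hterm : ∀ n : ℤ, (|(n : ℝ)| / t) ^ 2 * ‖J.propagator t φ n‖ ^ 2
      ≤ b ^ 2 * ‖J.propagator t φ n‖ ^ 2
        + (B ^ 2)⁻¹ * ((1 + |(n : ℝ)| / t) ^ (2 * 2) * ‖J.propagator t φ n‖ ^ 2)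
        + B ^ 2 * (b ^ p)⁻¹ * (t ^ p)⁻¹ * ((|(n : ℝ)| ^ p + 1) * ‖J.propagator t φ n‖ ^ 2) :=
    fun n => by
      simp only [← mul_assoc]
      rw [← add_mul, ← add_mul]
      refine mul_le_mul_of_nonneg_right ?_ (by positivity)
      have hx : 0 ≤ |(n : ℝ)| / t := by positivity
      refine (sq_le_add_rpow hx hb hB hp).trans ?_
      have c1 : (|(n : ℝ)| / t) ^ 4 / B ^ 2 ≤ (B ^ 2)⁻¹ * (1 + |(n : ℝ)| / t) ^ (2 * 2) := by
        rw [div_eq_inv_mul]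
        gcongr
        linarith
      have c2 : B ^ 2 * (b ^ p)⁻¹ * (|(n : ℝ)| / t) ^ p
          ≤ B ^ 2 * (b ^ p)⁻¹ * (t ^ p)⁻¹ * (|(n : ℝ)| ^ p + 1) := by
        rw [Real.div_rpow (abs_nonneg _) ht0.le, div_eq_inv_mul, ← mul_assoc]
        gcongr
        linarith
      linarith
  have sA := s0.summable.mul_left (b ^ 2)
  have sB := s4.mul_left (B ^ 2)⁻¹
  have sC := sp.mul_left (B ^ 2 * (b ^ p)⁻¹ * (t ^ p)⁻¹)
  have hsum := (Summable.of_nonneg_of_le (fun n => by positivity) hterm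
    ((sA.add sB).add sC)).tsum_le_tsum hterm ((sA.add sB).add sC)
  rw [(sA.add sB).tsum_add sC, sA.tsum_add sB, tsum_mul_left, tsum_mul_left, tsum_mul_left,
    s0.tsum_eq, hb2] at hsum
  have h4 : (B ^ 2)⁻¹ * ∑' n : ℤ, (1 + |(n : ℝ)| / t) ^ (2 * 2) * ‖J.propagator t φ n‖ ^ 2
      ≤ v ^ 2 / 16 := by
    rw [← hB2, div_eq_inv_mul]
    gcongr
  have h5 : v ^ 2 / 8 ≤ B ^ 2 * (b ^ p)⁻¹ * (t ^ p)⁻¹ * J.realMoment p φ t := by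
    rw [realMoment]
    linarith
  have htp : 0 < t ^ p := by positivity
  have hBb : 0 < B ^ 2 * (b ^ p)⁻¹ := by positivity
  rw [div_mul_eq_mul_div, div_le_iff₀ hBb]
  calc v ^ 2 / 8 * t ^ p ≤ B ^ 2 * (b ^ p)⁻¹ * (t ^ p)⁻¹ * J.realMoment p φ t * t ^ p := by gcongr
    _ = J.realMoment p φ t * (B ^ 2 * (b ^ p)⁻¹) := by field_simp

theorem moment_eq_ofReal {p t : ℝ} {φ : L2Z}
    (h : Summable fun n : ℤ => (|(n : ℝ)| ^ p + 1) * ‖J.propagator t φ n‖ ^ 2) :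
    J.moment p φ t = ENNReal.ofReal (J.realMoment p φ t) :=
  (ENNReal.ofReal_tsum_of_nonneg (fun n => by positivity) h).symm

theorem tendsto_log_div_log {f : ℝ → ℝ} {c C p : ℝ} (hc : 0 < c) (hp : 0 < p)
    (h : ∀ᶠ t : ℝ in atTop, c * t ^ p ≤ f t ∧ f t ≤ C * t ^ p) :
    Tendsto (fun t => Real.log (f t) / (p * Real.log t)) atTop (𝓝 1) := by
  have hlog : Tendsto (fun t => p * Real.log t) atTop atTop :=
    Real.tendsto_log_atTop.const_mul_atTop hp
  have hl : ∀ a : ℝ, Tendsto (fun t => a / (p * Real.log t) + 1) atTop (𝓝 1) := fun a => by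
    simpa using (tendsto_const_nhds.div_atTop hlog (a := a)).add_const 1
  refine tendsto_of_tendsto_of_tendsto_of_le_of_le' (hl (Real.log c)) (hl (Real.log C)) ?_ ?_
  · filter_upwards [h, eventually_gt_atTop 1] with t ht ht1
    have hL : 0 < p * Real.log t := mul_pos hp (Real.log_pos ht1)
    have ht0 : 0 < t := by linarith
    have htp : 0 < t ^ p := by positivity
    rw [← div_self hL.ne', ← add_div, ← Real.log_rpow ht0, ← Real.log_mul hc.ne' htp.ne']
    rw [Real.log_rpow ht0] at *
    gcongr
    exact ht.1
  · filter_upwards [h, eventually_gt_atTop 1] with t ht ht1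
    have hL : 0 < p * Real.log t := mul_pos hp (Real.log_pos ht1)
    have ht0 : 0 < t := by linarith
    have htp : 0 < t ^ p := by positivity
    have hf : 0 < f t := (mul_pos hc htp).trans_le ht.1
    have hC : 0 < C := pos_of_mul_pos_left (hf.trans_le ht.2) htp.le
    rw [← div_self hL.ne', ← add_div, ← Real.log_rpow ht0, ← Real.log_mul hC.ne' htp.ne']
    rw [Real.log_rpow ht0] at *
    gcongr
    exact ht.2

theorem tendsto_log_moment {Q : L2Z →L[ℂ] L2Z}
    (hQ : ∀ φ, Tendsto (fun t => J.meanVelocity t φ) atTop (𝓝 (Q φ))) {φ : L2Z}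
    (hφ : IsSchwartz φ) (hQφ : Q φ ≠ 0) {p : ℝ} (hp : 0 < p) :
    Tendsto (fun t : ℝ => ENNReal.log (J.moment p φ t) / ((p * Real.log t : ℝ) : EReal)) atTop
      (𝓝 1) := by
  obtain ⟨c, hc, hlow⟩ := exists_le_realMoment hQ hφ hQφ hp
  obtain ⟨C, -, hup⟩ := J.exists_realMoment_le hφ hp
  have h := tendsto_log_div_log (f := J.realMoment p φ) (C := C) hc hp (by
    filter_upwards [hlow, eventually_ge_atTop 1] with t h1 h2
    exact ⟨h1, (hup t h2).2⟩)
  have h' : Tendsto (fun t => ((Real.log (J.realMoment p φ t) / (p * Real.log t) : ℝ) : EReal))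
      atTop (𝓝 ((1 : ℝ) : EReal)) := (continuous_coe_real_ereal.tendsto 1).comp h
  refine h'.congr' ?_
  filter_upwards [hlow, eventually_ge_atTop 1] with t h1 h2
  have hpos : 0 < J.realMoment p φ t :=
    (mul_pos hc (Real.rpow_pos_of_pos (by linarith) p)).trans_le h1
  rw [moment_eq_ofReal (hup t h2).1, ENNReal.log_ofReal_of_pos hpos, EReal.coe_div]

end JacobiMatrix

end JacobiDynamics

end

/-! ### Assembly of the theorem. -/

theorem mainTheorem1 (R : ℝ) (hR : 0 < R) :
    ∃ η₀ : ℝ, 0 < η₀ ∧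
      ∀ J : JacobiDynamics.JacobiMatrix, J.IsExpClass η₀ → J.InClass R →
        (∃ Q : JacobiDynamics.L2Z →L[ℂ] JacobiDynamics.L2Z,
          IsSelfAdjoint Q ∧
          (∀ t : ℝ, (J.heisenberg t).domain = JacobiDynamics.position.domain) ∧
          JacobiDynamics.StronglyTendstoOn (fun t : ℝ => ((t⁻¹ : ℝ) : ℂ) • J.heisenberg t)
            JacobiDynamics.position.domain Q ∧
          {φ : JacobiDynamics.L2Z | Q φ = 0 ∧ Memℓp (fun n : ℤ => φ n) 1} = {0}) ∧
        ∀ φ : JacobiDynamics.L2Z, JacobiDynamics.IsSchwartz φ → φ ≠ 0 →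
          ∀ p : ℝ, 0 < p → J.betaPlus p φ = 1 ∧ J.betaMinus p φ = 1 := by
  have hL : 1 ≤ 2 * max R 1 := by linarith [le_max_right R 1]
  have hr := JacobiDynamics.JacobiMatrix.Approximants.rate_nonneg hL
  refine ⟨6 * (2 * JacobiDynamics.JacobiMatrix.Approximants.rate (2 * max R 1) + 1),
    by positivity, fun J hJ hJR => ?_⟩
  obtain ⟨Js, q, h⟩ := hJ.exists_approximants (by positivity) hJR
  obtain ⟨Q, hQ, hlim, hker⟩ := h.exists_asymptotic_velocity hL rfl
  refine ⟨⟨Q, hQ, J.heisenberg_domain, ?_, ?_⟩, fun φ hφ hφ0 p hp => ?_⟩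
  · exact ⟨fun t => (J.heisenberg_domain t).ge, fun φ hφ =>
      JacobiDynamics.JacobiMatrix.tendsto_inv_smul_heisenberg hlim ⟨φ, hφ⟩ _⟩
  · ext φ
    refine ⟨fun hφ => hker φ ?_ hφ.1, fun hφ => ?_⟩
    · simpa using hφ.2.summable (by norm_num)
    · rw [Set.mem_singleton_iff.1 hφ]
      exact ⟨map_zero Q, zero_memℓp⟩
  · have ht := JacobiDynamics.JacobiMatrix.tendsto_log_moment hlim hφ
      (fun h0 => hφ0 (hker φ hφ.summable_norm h0)) hp
    exact ⟨ht.limsup_eq, ht.liminf_eq⟩
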